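/- Let $n\ge 1$, let $F_2=\mathbb Z/2$, and let $W$ be a complex vector space. Write ${\bf x}=(x_1,\dots,x_n)$, ${\bf x}^{\bf m}=\prod_i x_i^{m_i}$ and $({\bf x}-{\bf y})^{\bf m}=\prod_i(x_i-y_i)^{m_i}$ for ${\bf m}\in\mathbb Z^n$, where an integer $k$ used as an exponent stands for $(k,\dots,k)$. Let $U(({\bf x}))=U[[{\bf x}]][x_1^{-1},\dots,x_n^{-1}]$, and similarly $U(({\bf x},{\bf y}))$. Powers of binomials are expanded by the convention $(x-y)^m=\sum_{j\ge0}\binom mj(-1)^jx^{m-j}y^j$. Put $${\bf z}^{-1}\delta\Big(\frac{{\bf x}-{\bf y}}{{\bf z}}\Big)=\sum_{{\bf m}\in\mathbb Z^n}({\bf x}-{\bf y})^{\bf m}{\bf z}^{-{\bf m}-1},\qquad {\bf y}^{-1}\delta\Big(\frac{{\bf x}-{\bf z}}{{\bf y}}\Big)=\sum_{{\bf m}\in\mathbb Z^n}({\bf x}-{\bf z})^{\bf m}{\bf y}^{-{\bf m}-1}.$$ **Vertex operators.** $VO_{G_n}(W)$ is the space of series $\psi({\bf x})=\sum_{{\bf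 m}\in\mathbb Z^n}\psi({\bf m}){\bf x}^{-{\bf m}-1}$ with $\psi({\bf m})\in\mathrm{End}\,W$ such that $\psi({\bf x})w\in W(({\bf x}))$ for all $w\in W$. Two elements $\psi,\phi$ are *mutually local* if $({\bf x}-{\bf y})^k\psi({\bf x})\phi({\bf y})=({\bf x}-{\bf y})^k\phi({\bf y})\psi({\bf x})$ for some $k\in\mathbb N$. A subspace of $VO_{G_n}(W)$ is *local* if any two of its elements (possibly equal) are mutually local. **Iota-maps.** For $\alpha\in F_2^n$ let $|\alpha|$ be the number of nonzero $\alpha_i$, and let $\iota_{\alpha,{\bf x},{\bf y}}(({\bf x}-{\bf y})^{\bf m})$ be the expansion of $\prod_i(x_i-y_i)^{m_i}$ in which the $i$-th factor is expanded in nonnegative powers of $y_i$ if $\alpha_i=0$, and as $(-y_i+x_i)^{m_i}$, in nonnegative powers of $x_i$, if $\alpha_i=1$. If $f({\bf x},{\bf y})$ is a series in integral powers of the $x_i,y_i$ with coefficients in $\mathrm{End}\,W$, and $({\bf x}-{\bf y})^kf({\bf x},{\bf y})w\in W(({\bf x},{\bf y}))$ for some $k\in\mathbb N$ and all $w\in W$,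 put $$\iota_{\alpha,{\bf x},{\bf y}}(f)w=\iota_{\alpha,{\bf x},{\bf y}}\big(({\bf x}-{\bf y})^{-k}\big)\,\big(({\bf x}-{\bf y})^kf({\bf x},{\bf y})w\big);$$ this does not depend on $k$. For series involving ${\bf z}$ as well, $\iota_{\alpha,{\bf x},{\bf y}}$ acts on the coefficients of the powers of ${\bf z}$. For mutually local $\psi,\phi\in VO_{G_n}(W)$ and ${\bf m}\in\mathbb Z^n$ put $$(\psi_{\bf m}\phi)({\bf y})=\sum_{\alpha\in F_2^n}(-1)^{|\alpha|}\,\mathrm{Res}_{\bf x}\,\iota_{\alpha,{\bf x},{\bf y}}\big(({\bf x}-{\bf y})^{\bf m}\psi({\bf x})\phi({\bf y})\big),$$ where $\mathrm{Res}_{\bf x}$ takes the coefficient of ${\bf x}^{-1}$. A local subspace $V$ of $VO_{G_n}(W)$ is *closed* if $\psi_{\bf m}\phi\in V$ for all $\psi,\phi\in V$ and ${\bf m}\in\mathbb Z^n$. **Vertex algebras and modules.** A *$G_n$-vertex algebra* is a complex vector space $V$ with a vector ${\bf 1}\in V$ and a linear map $v\mapsto Y(v,{\bf x})=\sum_{\bf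 m}v_{\bf m}{\bf x}^{-{\bf m}-1}$ from $V$ to $VO_{G_n}(V)$ such that $Y({\bf 1},{\bf x})=1$; $Y(v,{\bf x}){\bf 1}\in V[[{\bf x}]]$ has constant term $v$; any $Y(u,{\bf x})$ and $Y(v,{\bf x})$ are mutually local; and, for all $u,v\in V$, the Jacobi identity $${\bf y}^{-1}\delta\Big(\frac{{\bf x}-{\bf z}}{{\bf y}}\Big)Y(Y(u,{\bf z})v,{\bf y})=\sum_{\alpha\in F_2^n}(-1)^{|\alpha|}\iota_{\alpha,{\bf x},{\bf y}}\Big({\bf z}^{-1}\delta\Big(\frac{{\bf x}-{\bf y}}{{\bf z}}\Big)Y(u,{\bf x})Y(v,{\bf y})\Big)$$ holds. A *$V$-module* is a complex vector space $M$ with a linear map $Y_M$ from $V$ to $VO_{G_n}(M)$ such that $Y_M({\bf 1},{\bf x})=1$, any $Y_M(u,{\bf x})$ and $Y_M(v,{\bf x})$ are mutually local, and the Jacobi identity holds on $M$, that is, with $Y_M(Y(u,{\bf z})v,{\bf y})$ on the left and $Y_M(u,{\bf x})Y_M(v,{\bf y})$ on the right. **Theorem.** Let $V$ be a closed local subspace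 of $VO_{G_n}(W)$ that contains the identity operator $1$ of $W$ (as a constant series). Then $V$ is a $G_n$-vertex algebra with vacuum vector $1$ and with $Y(\psi,{\bf z})\phi=\sum_{{\bf m}\in\mathbb Z^n}(\psi_{\bf m}\phi){\bf z}^{-{\bf m}-1}$ for $\psi,\phi\in V$, and $W$ is a $V$-module with $Y_W(\psi,{\bf x})=\psi({\bf x})$ for $\psi\in V$. In particular, every maximal local subspace of $VO_{G_n}(W)$ is closed and contains $1$, and so is a $G_n$-vertex algebra in this way with $W$ as a module. -/

import Mathlib

namespace GVertex

/-- Exponent vectors: `a : Exp n` is the exponent of the monomial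
`x ^ a = x_1 ^ a_1 ⋯ x_n ^ a_n`. Integers (and natural numbers) used as exponent vectors are
the constant vectors. -/
abbrev Exp (n : ℕ) : Type := Fin n → ℤ

/-- Formal series with coefficients in `End W` and with exponents in the group `G`, given by their
coefficients. For `G = Exp n` this is `(End W)[[x_1, x_1⁻¹, …, x_n, x_n⁻¹]]`; for
`G = Exp n × Exp n` the pair `(a, b)` is the exponent of `x ^ a y ^ b`; for
`G = Exp n × Exp n × Exp n` the triple `(a, b, c)` is the exponent of `x ^ a y ^ b z ^ c`. -/
abbrev OpSeries (G : Type) (W : Type*) [AddCommGroup W] [Module ℂ W] : Type _ :=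
  G → Module.End ℂ W

/-- A series `f` is a lower truncated Laurent series, i.e. belongs to `U((x))`
(or to `U((x, y))`, when `G = Exp n × Exp n`): its exponents are bounded below in every variable. -/
def IsLaurent {G : Type} [Preorder G] {U : Type*} [Zero U] (f : G → U) : Prop :=
  BddBelow (Function.support f)

section

variable {W : Type*} [AddCommGroup W] [Module ℂ W]

open Classical in
/-- The product of a scalar series `c` and an `End W`-valued series `f`. The coefficient of index
`g` exists if, on every vector `w`, only finitely many terms `c p • f (g - p) w` are nonzero, and
is then their sum (coefficients that do not exist are set to `0`). -/
noncomputable def mulSeries {G : Type} [AddCommGroup G] (c : G → ℂ) (f : OpSeries G W) :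
    OpSeries G W := fun g =>
  if h : ∀ w : W, (Function.support fun p => c p • f (g - p) w).Finite then
    { toFun := fun w => ∑ᶠ p, c p • f (g - p) w
      map_add' := fun v w => by
        rw [← finsum_add_distrib (h v) (h w)]
        simp only [map_add, smul_add]
      map_smul' := fun t w => by
        rw [RingHom.id_apply, smul_finsum' t (h w)]
        simp only [map_smul, smul_comm t] }
  else 0

/-- The coefficient of `x ^ p y ^ q` in the expansion of `(x - y) ^ m` (one variable `x`, one
variable `y`, `m : ℤ`): in nonnegative powers of `y` if `ε = 0`, that is
`∑ j ≥ 0, (m choose j) x ^ (m - j) (-y) ^ j`, and in nonnegative powers of `x` otherwise, that is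
`∑ j ≥ 0, (m choose j) (-y) ^ (m - j) x ^ j`. -/
noncomputable def binomCoeff (ε : ZMod 2) (m p q : ℤ) : ℂ :=
  if p + q = m then
    if ε = 0 then
      if 0 ≤ q then ((Ring.choose m q.toNat : ℤ) : ℂ) * (-1) ^ q else 0
    else
      if 0 ≤ p then ((Ring.choose m p.toNat : ℤ) : ℂ) * (-1) ^ q else 0
  else 0

variable {n : ℕ}

/-- The scalar series `ι_{α,x,y} ((x - y) ^ m)` for `m ∈ ℤ ^ n`. For `α = 0` it is `(x - y) ^ m`
in the binomial expansion convention; for `m ≥ 0` it is the polynomial `(x - y) ^ m`, whatever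
`α` is. -/
noncomputable def subPow (α : Fin n → ZMod 2) (m : Exp n) : Exp n × Exp n → ℂ := fun g =>
  ∏ i, binomCoeff (α i) (m i) (g.1 i) (g.2 i)

/-- The space of `G_n`-vertex operators on `W`: the series `ψ(x)` with `ψ(x) w ∈ W((x))` for all
`w ∈ W`. The mode `ψ(m)`, with `ψ(x) = ∑ ψ(m) x ^ (- m - 1)`, is the coefficient `ψ (-m - 1)`. -/
def VO (n : ℕ) (W : Type*) [AddCommGroup W] [Module ℂ W] :
    Submodule ℂ (OpSeries (Exp n) W) where
  carrier := {ψ | ∀ w, IsLaurent fun a => ψ a w}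
  zero_mem' := fun w => by simp [IsLaurent]
  add_mem' := fun {ψ φ} hψ hφ w =>
    ((hψ w).union (hφ w)).mono (Function.support_add (fun a => ψ a w) (fun a => φ a w))
  smul_mem' := fun t ψ hψ w =>
    (hψ w).mono (Function.support_const_smul_subset t (fun a => ψ a w))

/-- The identity operator of `W`, as a constant series. -/
def idSeries (n : ℕ) (W : Type*) [AddCommGroup W] [Module ℂ W] : OpSeries (Exp n) W :=
  Pi.single 0 1

/-- The product `ψ(x) φ(y)`. -/
def prodXY (ψ φ : OpSeries (Exp n) W) : OpSeries (Exp n × Exp n) W := fun g => ψ g.1 * φ g.2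

/-- The product `φ(y) ψ(x)`. -/
def prodYX (ψ φ : OpSeries (Exp n) W) : OpSeries (Exp n × Exp n) W := fun g => φ g.2 * ψ g.1

/-- Mutual locality: `(x - y) ^ k ψ(x) φ(y) = (x - y) ^ k φ(y) ψ(x)` for some `k ∈ ℕ`. -/
def MutuallyLocal (ψ φ : OpSeries (Exp n) W) : Prop :=
  ∃ k : ℕ, mulSeries (subPow 0 (k : Exp n)) (prodXY ψ φ) =
    mulSeries (subPow 0 (k : Exp n)) (prodYX ψ φ)

/-- `(x - y) ^ k f(x, y) ∈ Hom (W, W((x, y)))`. -/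
def ClearsPole (k : ℕ) (f : OpSeries (Exp n × Exp n) W) : Prop :=
  ∀ w, IsLaurent fun g => mulSeries (subPow 0 (k : Exp n)) f g w

open Classical in
/-- The generalized iota-map `ι_{α,x,y}`, on the series `f(x, y)` for which some
`(x - y) ^ k f(x, y)` lies in `Hom (W, W((x, y)))`:
`ι_{α,x,y} (f) = ι_{α,x,y} ((x - y) ^ (-k)) ((x - y) ^ k f)`, which does not depend on `k`.
(Other series are sent to `0`.) -/
noncomputable def iota (α : Fin n → ZMod 2) (f : OpSeries (Exp n × Exp n) W) :
    OpSeries (Exp n × Exp n) W :=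
  if h : ∃ k : ℕ, ClearsPole k f then
    mulSeries (subPow α (-(h.choose : Exp n))) (mulSeries (subPow 0 (h.choose : Exp n)) f)
  else 0

/-- `∑ α ∈ (F_2) ^ n, (-1) ^ |α| ι_{α,x,y} ((x - y) ^ m ψ(x) φ(y))`. -/
noncomputable def iotaSum (ψ φ : OpSeries (Exp n) W) (m : Exp n) : OpSeries (Exp n × Exp n) W :=
  ∑ α : Fin n → ZMod 2,
    (-1 : ℂ) ^ hammingNorm α • iota α (mulSeries (subPow 0 m) (prodXY ψ φ))

/-- The product `(ψ_m φ)(y) = ∑ α, (-1) ^ |α| Res_x ι_{α,x,y} ((x - y) ^ m ψ(x) φ(y))`, where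
`Res_x` is the coefficient of `x_1⁻¹ ⋯ x_n⁻¹`. -/
noncomputable def nthProd (ψ : OpSeries (Exp n) W) (m : Exp n) (φ : OpSeries (Exp n) W) :
    OpSeries (Exp n) W := fun b => iotaSum ψ φ m (-1, b)

/-- The scalar series `y⁻¹ δ((x - z) / y) = ∑ r, (x - z) ^ r y ^ (- r - 1)`, where `(x - z) ^ r` is
expanded in nonnegative powers of `z`. -/
noncomputable def deltaXZY : Exp n × Exp n × Exp n → ℂ := fun g =>
  subPow 0 (-g.2.1 - 1) (g.1, g.2.2)

/-- The iterate `Y_W (Y(u, z) v, y)`, as a series in `x, y, z` that does not involve `x`. -/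
def iterate {V : Type*} [AddCommGroup V] [Module ℂ V] (Y : V → OpSeries (Exp n) V)
    (YW : V → OpSeries (Exp n) W) (u v : V) : OpSeries (Exp n × Exp n × Exp n) W := fun g =>
  if g.1 = 0 then YW (Y u g.2.2 v) g.2.1 else 0

/-- The Jacobi identity on `W` for `u, v ∈ V`:
`y⁻¹ δ((x - z) / y) Y_W (Y(u, z) v, y)
  = ∑ α, (-1) ^ |α| ι_{α,x,y} (z⁻¹ δ((x - y) / z) Y_W(u, x) Y_W(v, y))`.
On the right, `ι_{α,x,y}` acts on the coefficients of the powers of `z`, and the coefficient of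
`z ^ c` in `z⁻¹ δ((x - y) / z) = ∑ m, (x - y) ^ m z ^ (- m - 1)` is `(x - y) ^ (- c - 1)`. -/
def JacobiIdentity {V : Type*} [AddCommGroup V] [Module ℂ V] (Y : V → OpSeries (Exp n) V)
    (YW : V → OpSeries (Exp n) W) (u v : V) : Prop :=
  ∀ a b c : Exp n, mulSeries deltaXZY (iterate Y YW u v) (a, b, c) =
    iotaSum (YW u) (YW v) (-c - 1) (a, b)

end

/-- `G_n`-vertex algebra structures on the vector space `V`. `Y v a` is the coefficient of `x ^ a`
in `Y(v, x)`, so that the mode `v_m` is `Y v (-m - 1)`. -/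
structure GVertexAlgebra (n : ℕ) (V : Type*) [AddCommGroup V] [Module ℂ V] where
  /-- the vertex operator map -/
  Y : V →ₗ[ℂ] OpSeries (Exp n) V
  /-- the vacuum vector -/
  one : V
  /-- `Y(u, x) v ∈ V((x))` -/
  truncation : ∀ u, Y u ∈ VO n V
  /-- `Y(1, x) = 1` -/
  vacuum : Y one = idSeries n V
  /-- `Y(v, x) 1 ∈ V[[x]]` -/
  creation : ∀ v a, ¬ 0 ≤ a → Y v a one = 0
  /-- the constant term of `Y(v, x) 1` is `v` -/
  creation_zero : ∀ v, Y v 0 one = v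
  /-- weak commutativity -/
  weak_comm : ∀ u v, MutuallyLocal (Y u) (Y v)
  /-- Jacobi identity -/
  jacobi : ∀ u v, JacobiIdentity Y Y u v

/-- Module structures on the vector space `W` over a `G_n`-vertex algebra `A` with underlying
space `V`. -/
structure GVertexModule {n : ℕ} {V : Type*} [AddCommGroup V] [Module ℂ V]
    (A : GVertexAlgebra n V) (W : Type*) [AddCommGroup W] [Module ℂ W] where
  /-- the action -/
  Y : V →ₗ[ℂ] OpSeries (Exp n) W
  /-- `Y(v, x) w ∈ W((x))` -/
  truncation : ∀ v, Y v ∈ VO n W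
  /-- `Y(1, x) = 1` -/
  vacuum : Y A.one = idSeries n W
  /-- weak commutativity on `W` -/
  weak_comm : ∀ u v, MutuallyLocal (Y u) (Y v)
  /-- Jacobi identity on `W` -/
  jacobi : ∀ u v, JacobiIdentity A.Y Y u v

section

variable {n : ℕ} {W : Type*} [AddCommGroup W] [Module ℂ W]

/-- Local subspaces of `VO_{G_n}(W)`: any two of their elements (maybe the same) are mutually
local. -/
def IsLocalSubspace (V : Submodule ℂ (OpSeries (Exp n) W)) : Prop :=
  V ≤ VO n W ∧ ∀ ψ ∈ V, ∀ φ ∈ V, MutuallyLocal ψ φ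

/-- Closed local subspaces: `ψ_m φ ∈ V` for `ψ, φ ∈ V` and `m ∈ ℤ ^ n`. -/
def IsClosedLocalSubspace (V : Submodule ℂ (OpSeries (Exp n) W)) : Prop :=
  IsLocalSubspace V ∧ ∀ ψ ∈ V, ∀ φ ∈ V, ∀ m, nthProd ψ m φ ∈ V

/-- The operations `ψ_m φ` and the identity operator as vacuum vector make `V` a `G_n`-vertex
algebra, and `W` is a module over it, on which each `ψ ∈ V` is represented by the vertex operator
`ψ(x)` itself. -/
def IsVertexAlgebraWithNaturalModule (V : Submodule ℂ (OpSeries (Exp n) W)) : Prop :=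
  ∃ A : GVertexAlgebra n V,
    (A.one : OpSeries (Exp n) W) = idSeries n W ∧
    (∀ (ψ φ : V) (m : Exp n),
      (A.Y ψ (-m - 1) φ : OpSeries (Exp n) W) = nthProd (ψ : OpSeries (Exp n) W) m φ) ∧
    ∃ M : GVertexModule A W, ∀ ψ : V, M.Y ψ = (ψ : OpSeries (Exp n) W)

end

end GVertex

/-! Everything reduces to one substitution. If `ψ` and `φ` are mutually local, then (x - y)^k
ψ(x)φ(y)w is a Laurent series. Hence x = y + z can be substituted in it, expanded in nonnegative
powers of z, and the result divided by z^k; this is `expand`. In one variable, the difference of the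
two expansions of (x - y)^m is zero for m ≥ 0 and a divided derivative of a delta series for m < 0
(`binomCoeff_sub`). The alternating sum over F_2^n is a product of such differences
(`sum_sign_subPow`), and its residue reads off a Taylor coefficient. So the series of all ψ_m φ is
the expansion of ψ(y + z)φ(y) (`nthProd_apply`). Taking any power of x instead of the residue,
Vandermonde's identity gives the Jacobi identity for every pair with Y(u_m v) = Y(u)_m Y(v)
(`jacobiIdentity_of_nthProd`). On `W` this relation is the definition of the products.

On `V`, two facts remain: the operators Y(u) and Y(v) are mutually local, and Y(u_m v) = Y(u)_m
Y(v). Both come from u(x)v(y)w(z)ω, which becomes a Laurent series H after multiplication by powers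
of x - y, x - z and y - z. On H, the substitutions x ↦ z + x and y ↦ z + y commute
(`expand₁₃_expand₂₃_comm`), and following them by x ↦ y + x amounts to x ↦ y + x followed by y ↦ z +
y (`expand₁₂_expand₁₃_expand₂₃`). To return from H to the product itself, the polynomial factor is
carried through the substitutions (`polyEnd_intertwine`). It becomes monomials, which are
invertible, times a power of x - y, which is the locality factor wanted on `V`, or, for
associativity, a power of x + y, which is injective on series with x-exponents bounded below
(`eq_zero_of_act₃_prod_add`).

For a maximal local subspace, an operator local with itself and with `V` already lies in `V`; the
identity is such an operator, and Dong's lemma (`MutuallyLocal.nthProd_left`) shows that ψ_m φ is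
one. -/

namespace GVertex

open MvPolynomial

/-! ### Polynomials acting on formal series -/

section ShiftAction

variable {σ τ G G' : Type} [AddCommGroup G] [AddCommGroup G'] {U U' : Type*} [AddCommGroup U]
  [Module ℂ U] [AddCommGroup U'] [Module ℂ U']

/-- Multiplication of formal series by monomials, as a representation of the exponent group. -/
def shiftHom (G : Type) [AddCommGroup G] (U : Type*) [AddCommGroup U] [Module ℂ U] :
    Multiplicative G →* Module.End ℂ (G → U) where
  toFun p :=
    { toFun := fun f g => f (g - p.toAdd)
      map_add' := fun _ _ => rfl
      map_smul' := fun _ _ => rfl }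
  map_one' := by ext f g; simp
  map_mul' p q := by
    ext f g
    simp only [toAdd_mul, LinearMap.coe_mk, AddHom.coe_mk, Module.End.mul_apply]
    congr 1; abel

/-- Multiplication of formal series by polynomials, where the variable `s` stands for the monomial
with exponent `e s`. -/
noncomputable def polyEnd (e : σ → G) (U : Type*) [AddCommGroup U] [Module ℂ U] :
    MvPolynomial σ ℂ →ₐ[ℂ] Module.End ℂ (G → U) :=
  (AddMonoidAlgebra.lift ℂ (Module.End ℂ (G → U)) G (shiftHom G U)).comp
    (aeval fun s => AddMonoidAlgebra.single (e s) 1)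

theorem polyEnd_X (e : σ → G) (s : σ) (F : G → U) (g : G) :
    polyEnd e U (X s) F g = F (g - e s) := by
  simp [polyEnd, shiftHom]

theorem polyEnd_C (e : σ → G) (c : ℂ) (F : G → U) : polyEnd e U (C c) F = c • F := by
  rw [← algebraMap_eq, AlgHom.commutes, Module.algebraMap_end_apply]

theorem polyEnd_mul_apply (e : σ → G) (p q : MvPolynomial σ ℂ) (F : G → U) :
    polyEnd e U (p * q) F = polyEnd e U p (polyEnd e U q F) := by
  rw [map_mul, Module.End.mul_apply]

theorem polyEnd_mem (e : σ → G) (S : Submodule ℂ (G → U))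
    (hS : ∀ s, ∀ F ∈ S, polyEnd e U (X s) F ∈ S) (p : MvPolynomial σ ℂ) :
    ∀ F ∈ S, polyEnd e U p F ∈ S := by
  induction p using MvPolynomial.induction_on with
  | C a => intro F hF; rw [polyEnd_C]; exact S.smul_mem _ hF
  | add p q hp hq =>
    intro F hF
    rw [map_add]; exact S.add_mem (hp F hF) (hq F hF)
  | mul_X p s hp =>
    intro F hF
    rw [polyEnd_mul_apply]; exact hp _ (hS s F hF)

/-- A map that is linear on an invariant subspace `S` and intertwines the variables
intertwines all polynomials. -/
theorem polyEnd_intertwine {e : σ → G} {e' : τ → G'}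
    (θ : MvPolynomial σ ℂ →ₐ[ℂ] MvPolynomial τ ℂ) (S : Submodule ℂ (G → U))
    (hS : ∀ s, ∀ F ∈ S, polyEnd e U (X s) F ∈ S) (Λ : (G → U) → (G' → U'))
    (hadd : ∀ F ∈ S, ∀ F' ∈ S, Λ (F + F') = Λ F + Λ F')
    (hsmul : ∀ (c : ℂ), ∀ F ∈ S, Λ (c • F) = c • Λ F)
    (hX : ∀ s, ∀ F ∈ S, Λ (polyEnd e U (X s) F) = polyEnd e' U' (θ (X s)) (Λ F))
    (p : MvPolynomial σ ℂ) :
    ∀ F ∈ S, Λ (polyEnd e U p F) = polyEnd e' U' (θ p) (Λ F) := by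
  induction p using MvPolynomial.induction_on with
  | C a =>
    intro F hF
    rw [← algebraMap_eq, AlgHom.commutes θ, algebraMap_eq, algebraMap_eq, polyEnd_C, polyEnd_C,
      hsmul _ _ hF]
  | add p q hp hq =>
    intro F hF
    rw [map_add, map_add, map_add, LinearMap.add_apply, LinearMap.add_apply,
      hadd _ (polyEnd_mem e S hS p F hF) _ (polyEnd_mem e S hS q F hF), hp F hF, hq F hF]
  | mul_X p s hp =>
    intro F hF
    rw [polyEnd_mul_apply, map_mul, polyEnd_mul_apply, hp _ (hS s F hF), hX s F hF]

/-- The special case of `polyEnd_intertwine` for maps between series in the same variables. -/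
theorem polyEnd_comm {e : σ → G} {e' : σ → G'} (S : Submodule ℂ (G → U))
    (hS : ∀ s, ∀ F ∈ S, polyEnd e U (X s) F ∈ S) (Λ : (G → U) → (G' → U'))
    (hadd : ∀ F ∈ S, ∀ F' ∈ S, Λ (F + F') = Λ F + Λ F')
    (hsmul : ∀ (c : ℂ), ∀ F ∈ S, Λ (c • F) = c • Λ F)
    (hX : ∀ s, ∀ F ∈ S, Λ (polyEnd e U (X s) F) = polyEnd e' U' (X s) (Λ F))
    (p : MvPolynomial σ ℂ) :
    ∀ F ∈ S, Λ (polyEnd e U p F) = polyEnd e' U' p (Λ F) :=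
  polyEnd_intertwine (AlgHom.id ℂ _) S hS Λ hadd hsmul hX p

theorem polyEnd_map (e : σ → G) (L : U →ₗ[ℂ] U') (p : MvPolynomial σ ℂ) (F : G → U) (g : G) :
    L (polyEnd e U p F g) = polyEnd e U' p (fun g => L (F g)) g := by
  refine congrFun (polyEnd_comm (e := e) (e' := e) ⊤ (fun _ _ _ => trivial)
    (fun F g => L (F g)) ?_ ?_ ?_ p F trivial) g
  · intros; ext; simp
  · intros; ext; simp
  · intros; ext; simp [polyEnd_X]

end ShiftAction

/-! ### Binomial coefficients with integer arguments -/

section Binomials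

/-- The binomial coefficient `r.choose j` for integers `r, j`; it is zero for negative `j`. -/
def intChoose (r j : ℤ) : ℤ := if 0 ≤ j then Ring.choose r j.toNat else 0

theorem intChoose_of_neg {r j : ℤ} (h : j < 0) : intChoose r j = 0 := if_neg (not_le.2 h)

theorem intChoose_natCast (r : ℤ) (j : ℕ) : intChoose r j = Ring.choose r j := by
  simp [intChoose]

theorem intChoose_zero_right (r : ℤ) : intChoose r 0 = 1 := by simp [intChoose]

theorem intChoose_zero_left (j : ℤ) : intChoose 0 j = if j = 0 then 1 else 0 := by
  rcases lt_trichotomy j 0 with h | rfl | h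
  · rw [intChoose_of_neg h, if_neg h.ne]
  · simp [intChoose]
  · lift j to ℕ using h.le
    rw [intChoose_natCast, if_neg h.ne', Ring.choose_zero_ite, if_neg (by exact_mod_cast h.ne')]

theorem intChoose_succ (r j : ℤ) : intChoose (r + 1) j = intChoose r j + intChoose r (j - 1) := by
  rcases lt_trichotomy j 0 with h | rfl | h
  · rw [intChoose_of_neg h, intChoose_of_neg h, intChoose_of_neg (by lia), add_zero]
  · simp [intChoose]
  · obtain ⟨k, rfl⟩ : ∃ k : ℕ, j = k + 1 := ⟨(j - 1).toNat, by lia⟩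
    rw [add_sub_cancel_right, intChoose_natCast,
      show ((k : ℤ) + 1) = ((k + 1 : ℕ) : ℤ) by push_cast; rfl, intChoose_natCast,
      intChoose_natCast, Ring.choose_succ_succ, add_comm]

theorem intChoose_natCast_eq_zero {r : ℕ} {j : ℤ} (h : (r : ℤ) < j) : intChoose r j = 0 := by
  lift j to ℕ using by lia
  rw [intChoose_natCast, Ring.choose_natCast, Nat.choose_eq_zero_of_lt (by exact_mod_cast h)]
  rfl

theorem intChoose_add (r s j : ℤ) :
    intChoose (r + s) j = ∑ t ∈ Finset.Icc 0 j, intChoose r t * intChoose s (j - t) := by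
  rcases lt_or_ge j 0 with h | h
  · rw [intChoose_of_neg h, Finset.Icc_eq_empty (by lia), Finset.sum_empty]
  · lift j to ℕ using h
    rw [intChoose_natCast, Ring.add_choose_eq j (Commute.all r s)]
    refine Finset.sum_bij (fun ij _ => (ij.1 : ℤ)) ?_ ?_ ?_ ?_
    · rintro ⟨a, b⟩ hab
      rw [Finset.HasAntidiagonal.mem_antidiagonal] at hab
      simp only [Finset.mem_Icc]; lia
    · rintro ⟨a, b⟩ hab ⟨c, d⟩ hcd h
      rw [Finset.HasAntidiagonal.mem_antidiagonal] at hab hcd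
      simp only [Prod.mk.injEq]; lia
    · intro t ht
      simp only [Finset.mem_Icc] at ht
      exact ⟨(t.toNat, (j - t).toNat),
        by rw [Finset.HasAntidiagonal.mem_antidiagonal]; dsimp only; lia, by simp [ht.1]⟩
    · rintro ⟨a, b⟩ hab
      rw [Finset.HasAntidiagonal.mem_antidiagonal] at hab
      rw [show (j : ℤ) - a = b by lia, intChoose_natCast, intChoose_natCast]

theorem intChoose_mul (r q i : ℤ) :
    intChoose r q * intChoose q i = intChoose r i * intChoose (r - i) (q - i) := by
  rcases lt_or_ge q 0 with h | hq
  · rw [intChoose_of_neg h]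
    rcases lt_or_ge i 0 with h' | h'
    · simp only [intChoose_of_neg h', mul_zero, zero_mul]
    · rw [intChoose_of_neg (show q - i < 0 by lia)]; ring
  rcases lt_or_ge i 0 with h' | hi
  · rw [intChoose_of_neg h', intChoose_of_neg h']; ring
  rcases lt_or_ge q i with h | h
  · rw [intChoose_of_neg (show q - i < 0 by lia)]
    lift q to ℕ using hq
    rw [intChoose_natCast_eq_zero h]; ring
  · lift q to ℕ using hq
    lift i to ℕ using hi
    have hle : i ≤ q := by exact_mod_cast h
    rw [show (q : ℤ) - i = ((q - i : ℕ) : ℤ) by push_cast [hle]; rfl]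
    simp only [intChoose_natCast]
    have := Ring.choose_smul_choose r hle
    rw [nsmul_eq_mul] at this
    rw [Ring.choose_natCast, ← this, mul_comm]

theorem intChoose_neg (r : ℤ) (j : ℕ) :
    intChoose (-r - 1) j = (-1) ^ j * intChoose (r + j) j := by
  rw [intChoose_natCast, intChoose_natCast, show -r - 1 = -(r + 1) by ring, Ring.choose_neg]
  simp [Int.negOnePow_def, Units.smul_def]
  ring_nf

variable {n : ℕ}

/-- The product of the binomial coefficients of the entries of two exponent vectors. -/
noncomputable def vecChoose (r j : Exp n) : ℂ := ∏ i, (intChoose (r i) (j i) : ℂ)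

theorem vecChoose_eq_zero {r j : Exp n} (h : ¬ 0 ≤ j) : vecChoose r j = 0 := by
  simp only [Pi.le_def, not_forall, not_le] at h
  obtain ⟨i, hi⟩ := h
  exact Finset.prod_eq_zero (Finset.mem_univ i) (by rw [intChoose_of_neg hi]; simp)

theorem vecChoose_zero_right (r : Exp n) : vecChoose r 0 = 1 := by
  simp [vecChoose, intChoose_zero_right]

theorem vecChoose_zero_left (j : Exp n) : vecChoose 0 j = if j = 0 then 1 else 0 := by
  simp only [vecChoose, Pi.zero_apply, intChoose_zero_left]
  split_ifs with h
  · simp [h]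
  · obtain ⟨i, hi⟩ := Function.ne_iff.1 h
    exact Finset.prod_eq_zero (Finset.mem_univ i) (by simpa using hi)

theorem vecChoose_add_single (r j : Exp n) (l : Fin n) :
    vecChoose (r + Pi.single l 1) j = vecChoose r j + vecChoose r (j - Pi.single l 1) := by
  have h : ∀ i ∈ Finset.univ.erase l, (intChoose ((r + Pi.single l 1 : Exp n) i) (j i) : ℂ) =
      intChoose (r i) (j i) := fun i hi => by
    rw [Pi.add_apply, Pi.single_eq_of_ne (Finset.ne_of_mem_erase hi), add_zero]
  have h' : ∀ i ∈ Finset.univ.erase l, (intChoose (r i) ((j - Pi.single l 1 : Exp n) i) : ℂ) =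
      intChoose (r i) (j i) := fun i hi => by
    rw [Pi.sub_apply, Pi.single_eq_of_ne (Finset.ne_of_mem_erase hi), sub_zero]
  simp only [vecChoose]
  simp only [← Finset.mul_prod_erase Finset.univ _ (Finset.mem_univ l)]
  rw [Finset.prod_congr rfl h, Finset.prod_congr rfl h', ← add_mul, Pi.add_apply, Pi.sub_apply,
    Pi.single_eq_same, intChoose_succ, Int.cast_add]

theorem vecChoose_add (r s j : Exp n) :
    vecChoose (r + s) j = ∑ t ∈ Finset.Icc 0 j, vecChoose r t * vecChoose s (j - t) := by
  simp only [vecChoose, Pi.add_apply, Pi.sub_apply, intChoose_add, Int.cast_sum, Int.cast_mul,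
    Finset.prod_univ_sum, Finset.prod_mul_distrib]
  rfl

theorem vecChoose_mul (r q i : Exp n) :
    vecChoose r q * vecChoose q i = vecChoose r i * vecChoose (r - i) (q - i) := by
  simp only [vecChoose, ← Finset.prod_mul_distrib, ← Int.cast_mul, intChoose_mul, Pi.sub_apply]

/-- Both sides are the coefficient of x^i y^j in (z + y + x)^r (z + y)^s. On the left the first
factor is expanded in powers of y + x, with exponent q; on the right x is separated first. The proof
is trinomial revision followed by Vandermonde. -/
theorem vecChoose_comp (r s i j : Exp n) :
    ∑ q ∈ Finset.Icc 0 (j + i), vecChoose q i * (vecChoose r q * vecChoose s (j + i - q)) =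
      vecChoose r i * vecChoose (s + r - i) j := by
  have : ∀ q, vecChoose q i * (vecChoose r q * vecChoose s (j + i - q)) =
      vecChoose r i * (vecChoose (r - i) (q - i) * vecChoose s (j + i - q)) := fun q => by
    rw [← mul_assoc, ← mul_assoc, mul_comm (vecChoose q i), vecChoose_mul]
  simp only [this, ← Finset.mul_sum]
  by_cases hi : 0 ≤ i
  swap
  · rw [vecChoose_eq_zero hi, zero_mul, zero_mul]
  rw [show s + r - i = (r - i) + s by abel, vecChoose_add]
  congr 1
  rw [← Finset.sum_subset (Finset.Icc_subset_Icc_left hi) fun q hq hq' => by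
    rw [vecChoose_eq_zero, zero_mul]
    exact fun h => hq' (Finset.mem_Icc.2 ⟨sub_nonneg.1 h, (Finset.mem_Icc.1 hq).2⟩)]
  refine Finset.sum_bij (fun q _ => q - i) ?_ ?_ ?_ ?_
  · intro q hq
    rw [Finset.mem_Icc] at hq ⊢
    exact ⟨sub_nonneg.2 hq.1, sub_le_iff_le_add.2 hq.2⟩
  · intro q _ q' _ h
    exact sub_left_injective h
  · intro t ht
    rw [Finset.mem_Icc] at ht
    exact ⟨t + i, Finset.mem_Icc.2 ⟨le_add_of_nonneg_left ht.1, add_le_add_left ht.2 i⟩, by simp⟩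
  · intro q _
    rw [show j - (q - i) = j + i - q by abel]

end Binomials

/-! ### The two expansions of powers of x - y and their difference -/

section Expansions

theorem intChoose_symm {a b : ℤ} (h : 0 ≤ a + b) : intChoose (a + b) a = intChoose (a + b) b := by
  rcases lt_or_ge a 0 with ha | ha
  · rw [intChoose_of_neg ha]
    obtain ⟨k, hk⟩ := Int.eq_ofNat_of_zero_le h
    rw [hk, intChoose_natCast_eq_zero (by lia)]
  rcases lt_or_ge b 0 with hb | hb
  · rw [intChoose_of_neg hb]
    obtain ⟨k, hk⟩ := Int.eq_ofNat_of_zero_le h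
    rw [hk, intChoose_natCast_eq_zero (by lia)]
  lift a to ℕ using ha
  lift b to ℕ using hb
  rw [intChoose_natCast, intChoose_natCast, ← Nat.cast_add, Ring.choose_natCast,
    Ring.choose_natCast, Nat.choose_symm_add]

theorem binomCoeff_eq (ε : ZMod 2) (m p q : ℤ) : binomCoeff ε m p q =
    if p + q = m then ((if ε = 0 then intChoose m q else intChoose m p : ℤ) : ℂ) * (-1) ^ q
    else 0 := by
  unfold binomCoeff intChoose
  split_ifs <;> simp

theorem binomCoeff_succ (ε : ZMod 2) (m p q : ℤ) :
    binomCoeff ε m (p - 1) q - binomCoeff ε m p (q - 1) = binomCoeff ε (m + 1) p q := by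
  simp only [binomCoeff_eq]
  by_cases h : p + q = m + 1
  · rw [if_pos h, if_pos (show p - 1 + q = m by lia), if_pos (show p + (q - 1) = m by lia),
      intChoose_succ m q, intChoose_succ m p, zpow_sub_one₀ (by norm_num)]
    split_ifs <;> push_cast <;> ring
  · rw [if_neg h, if_neg (show p - 1 + q ≠ m by lia), if_neg (show p + (q - 1) ≠ m by lia),
      sub_zero]

/-- For m ≥ 0 both expansions are the same polynomial. For m < 0 they differ by a divided derivative
of the delta series, whose coefficients are given by one binomial formula for all p. -/
theorem binomCoeff_sub (m p q : ℤ) : binomCoeff 0 m p q - binomCoeff 1 m p q =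
    if p + q = m then (intChoose (-p - 1) (-m - 1) : ℂ) else 0 := by
  simp only [binomCoeff_eq]
  by_cases h : p + q = m
  swap
  · simp [h]
  rw [if_pos h, if_pos h, if_pos h, if_pos trivial, if_neg (show (1 : ZMod 2) ≠ 0 by decide),
    ← sub_mul]
  subst h
  rcases le_or_gt 0 (p + q) with h | h
  · rw [intChoose_symm h, intChoose_of_neg (show -(p + q) - 1 < 0 by lia)]
    simp
  obtain ⟨j, hj⟩ : ∃ j : ℕ, -(p + q) - 1 = j := ⟨(-(p + q) - 1).toNat, by lia⟩
  rw [hj]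
  have h' : p + q = -(j : ℤ) - 1 := by lia
  -- As p + q < 0, at most one of p and q is nonnegative. Only the first expansion contributes if q
  -- ≥ 0, only the second if p ≥ 0, and neither if both are negative.
  rcases le_or_gt 0 q with hq | hq
  · rw [intChoose_of_neg (show p < 0 by lia), h']
    lift q to ℕ using hq
    rw [intChoose_neg, show -p - 1 = (j : ℤ) + q by lia, intChoose_symm (by positivity)]
    push_cast
    rw [zpow_natCast, sub_zero, mul_right_comm, ← mul_pow]
    norm_num
  rw [intChoose_of_neg hq]
  rcases le_or_gt 0 p with hp | hp
  · rw [h']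
    lift p to ℕ using hp
    rw [intChoose_neg, intChoose_neg, add_comm (p : ℤ), intChoose_symm (by positivity),
      show q = -(j : ℤ) - 1 - p by lia, zpow_sub₀ (by norm_num), zpow_sub₀ (by norm_num)]
    push_cast
    simp only [zpow_neg, zpow_natCast, zpow_one, zero_sub]
    have h1 : ∀ k : ℕ, ((-1 : ℂ) ^ k)⁻¹ = (-1) ^ k := fun k => by rw [← inv_pow]; norm_num
    have h2 : ((-1 : ℂ) ^ p) * (-1) ^ p = 1 := by rw [← mul_pow]; norm_num
    rw [div_eq_mul_inv, h1, h1]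
    linear_combination (((-1 : ℂ) ^ j * (intChoose (j + p) p : ℂ)) * h2)
  · rw [intChoose_of_neg hp, show -p - 1 = ((-p - 1).toNat : ℤ) by lia,
      intChoose_natCast_eq_zero (by lia)]
    simp

variable {n : ℕ}

/-- The exponents of the variables of series in two sets of variables. -/
def pairExp (n : ℕ) : Fin n ⊕ Fin n → Exp n × Exp n :=
  Sum.elim (fun l => (Pi.single l 1, 0)) (fun l => (0, Pi.single l 1))

/-- The polynomial `(x - y) ^ k`. -/
noncomputable def diffPow (k : Fin n → ℕ) : MvPolynomial (Fin n ⊕ Fin n) ℂ :=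
  ∏ l, (X (Sum.inl l) - X (Sum.inr l)) ^ k l

/-- Multiplication of series in two sets of variables by polynomials. -/
noncomputable abbrev act₂ (U : Type*) [AddCommGroup U] [Module ℂ U] :
    MvPolynomial (Fin n ⊕ Fin n) ℂ →ₐ[ℂ] Module.End ℂ (Exp n × Exp n → U) :=
  polyEnd (pairExp n) U

theorem diffPow_add (k k' : Fin n → ℕ) : diffPow (k + k') = diffPow k * diffPow k' := by
  simp only [diffPow, Pi.add_apply, pow_add, Finset.prod_mul_distrib]

/-- Pascal's rule in the `l`-th variable. It holds for both expansions, so factors x - y can be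
absorbed whatever `α` is. -/
theorem act₂_sub_subPow (α : Fin n → ZMod 2) (m : Exp n) (l : Fin n) :
    act₂ ℂ (X (Sum.inl l) - X (Sum.inr l)) (subPow α m) = subPow α (m + Pi.single l 1) := by
  ext ⟨a, b⟩
  rw [map_sub, LinearMap.sub_apply, Pi.sub_apply, polyEnd_X, polyEnd_X]
  simp only [subPow, pairExp, Sum.elim_inl, Sum.elim_inr, Prod.fst_sub, Prod.snd_sub, sub_zero]
  simp only [← Finset.mul_prod_erase Finset.univ _ (Finset.mem_univ l)]
  have h : ∀ c : Exp n, ∀ i ∈ Finset.univ.erase l, (c + Pi.single l 1 : Exp n) i = c i :=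
    fun c i hi => by
      rw [Pi.add_apply, Pi.single_eq_of_ne (Finset.ne_of_mem_erase hi), add_zero]
  have h' : ∀ c : Exp n, ∀ i ∈ Finset.univ.erase l, (c - Pi.single l 1 : Exp n) i = c i :=
    fun c i hi => by
      rw [Pi.sub_apply, Pi.single_eq_of_ne (Finset.ne_of_mem_erase hi), sub_zero]
  have h₁ : ∏ i ∈ Finset.univ.erase l,
      binomCoeff (α i) (m i) ((a - Pi.single l 1 : Exp n) i) (b i) =
      ∏ i ∈ Finset.univ.erase l, binomCoeff (α i) (m i) (a i) (b i) :=
    Finset.prod_congr rfl fun i hi => by rw [h' a i hi]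
  have h₂ : ∏ i ∈ Finset.univ.erase l,
      binomCoeff (α i) (m i) (a i) ((b - Pi.single l 1 : Exp n) i) =
      ∏ i ∈ Finset.univ.erase l, binomCoeff (α i) (m i) (a i) (b i) :=
    Finset.prod_congr rfl fun i hi => by rw [h' b i hi]
  have h₃ : ∏ i ∈ Finset.univ.erase l,
      binomCoeff (α i) ((m + Pi.single l 1 : Exp n) i) (a i) (b i) =
      ∏ i ∈ Finset.univ.erase l, binomCoeff (α i) (m i) (a i) (b i) :=
    Finset.prod_congr rfl fun i hi => by rw [h m i hi]
  rw [h₁, h₂, h₃, ← sub_mul]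
  simp only [Pi.sub_apply, Pi.add_apply, Pi.single_eq_same, binomCoeff_succ]

theorem act₂_sub_pow_subPow (α : Fin n → ZMod 2) (m : Exp n) (l : Fin n) (k : ℕ) :
    act₂ ℂ ((X (Sum.inl l) - X (Sum.inr l)) ^ k) (subPow α m) =
      subPow α (m + Pi.single l (k : ℤ)) := by
  induction k with
  | zero => simp
  | succ k ih =>
    rw [pow_succ', polyEnd_mul_apply, ih, act₂_sub_subPow, add_assoc, ← Pi.single_add]
    push_cast; rfl

theorem act₂_diffPow_subPow (α : Fin n → ZMod 2) (m : Exp n) (k : Fin n → ℕ) :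
    act₂ ℂ (diffPow k) (subPow α m) = subPow α (m + fun i => (k i : ℤ)) := by
  have key : ∀ s : Finset (Fin n), act₂ ℂ (∏ l ∈ s, (X (Sum.inl l) - X (Sum.inr l)) ^ k l)
      (subPow α m) = subPow α (m + ∑ l ∈ s, Pi.single l (k l : ℤ)) := fun s => by
    induction s using Finset.induction_on with
    | empty => simp
    | insert l s hl ih =>
      rw [Finset.prod_insert hl, polyEnd_mul_apply, ih, act₂_sub_pow_subPow,
        Finset.sum_insert hl]
      congr 1; abel
  rw [diffPow, key, Finset.univ_sum_single]

theorem subPow_zero (α : Fin n → ZMod 2) : subPow α 0 = Pi.single 0 1 := by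
  have h1 : ∀ (ε : ZMod 2) (p q : ℤ), binomCoeff ε 0 p q = if p = 0 ∧ q = 0 then 1 else 0 := by
    intro ε p q
    rw [binomCoeff_eq, intChoose_zero_left, intChoose_zero_left]
    by_cases h : p = 0 ∧ q = 0
    · simp [h.1, h.2]
    · rw [if_neg h]
      split_ifs <;> lia
  ext ⟨a, b⟩
  simp only [subPow, Pi.zero_apply, h1, Pi.single_apply, Prod.mk_eq_zero]
  split_ifs with h
  · simp [h.1, h.2]
  · rw [not_and_or] at h
    rcases h with h | h <;> obtain ⟨i, hi⟩ := Function.ne_iff.1 h <;>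
      exact Finset.prod_eq_zero (Finset.mem_univ i) (by rw [if_neg]; tauto)

theorem subPow_natCast (α : Fin n → ZMod 2) (k : Fin n → ℕ) :
    subPow α (fun i => (k i : ℤ)) = act₂ ℂ (diffPow k) (Pi.single 0 1) := by
  rw [← subPow_zero α, act₂_diffPow_subPow, zero_add]

theorem subPow_eq_zero {α : Fin n → ZMod 2} {m : Exp n} {p : Exp n × Exp n}
    (h : p.1 + p.2 ≠ m) : subPow α m p = 0 := by
  obtain ⟨i, hi⟩ := Function.ne_iff.1 h
  exact Finset.prod_eq_zero (Finset.mem_univ i) (by rw [binomCoeff_eq]; exact if_neg hi)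

theorem subPow_zero_eq_zero {m : Exp n} {p : Exp n × Exp n}
    (h : ¬ 0 ≤ p.2) : subPow 0 m p = 0 := by
  simp only [Pi.le_def, not_forall, not_le] at h
  obtain ⟨i, hi⟩ := h
  refine Finset.prod_eq_zero (Finset.mem_univ i) ?_
  rw [binomCoeff_eq]
  simp [intChoose_of_neg hi]

/-- Upper negation absorbs the sign (-1)^t. -/
theorem subPow_zero_add (a t : Exp n) : subPow 0 (a + t) (a, t) = vecChoose (-a - 1) t := by
  refine Finset.prod_congr rfl fun i _ => ?_
  simp only [binomCoeff_eq, Pi.add_apply, Pi.zero_apply, Pi.sub_apply, Pi.neg_apply, Pi.one_apply,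
    if_true]
  rcases lt_or_ge (t i) 0 with h | h
  · simp [intChoose_of_neg h]
  · generalize t i = s at h ⊢
    lift s to ℕ using h
    rw [intChoose_neg, zpow_natCast, mul_comm]
    push_cast; rfl

/-- The sign and the expansion both factor over the coordinates, so the sum over F_2^n is a product
of the one-variable differences of `binomCoeff_sub`. -/
theorem sum_sign_subPow (m : Exp n) (p : Exp n × Exp n) :
    ∑ α : Fin n → ZMod 2, (-1 : ℂ) ^ hammingNorm α * subPow α m p =
      if p.1 + p.2 = m then vecChoose (-p.1 - 1) (-m - 1) else 0 := by
  have hs : ∀ α : Fin n → ZMod 2, (-1 : ℂ) ^ hammingNorm α =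
      ∏ i, if α i = 0 then 1 else -1 := fun α => by
    rw [hammingNorm, ← Finset.prod_const, Finset.prod_filter]
    exact Finset.prod_congr rfl fun i _ => by split_ifs <;> simp_all
  simp only [hs, subPow, ← Finset.prod_mul_distrib]
  rw [← Fintype.prod_sum fun i (ε : ZMod 2) =>
    (if ε = 0 then (1 : ℂ) else -1) * binomCoeff ε (m i) (p.1 i) (p.2 i)]
  have h2 : ∀ f : ZMod 2 → ℂ, ∑ ε, f ε = f 0 + f 1 := Fin.sum_univ_two
  simp only [h2, if_true, one_mul, if_neg (show (1 : ZMod 2) ≠ 0 by decide), neg_one_mul,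
    ← sub_eq_add_neg, binomCoeff_sub]
  split_ifs with h
  · exact Finset.prod_congr rfl fun i _ => if_pos (congrFun h i)
  · obtain ⟨i, hi⟩ := Function.ne_iff.1 h
    exact Finset.prod_eq_zero (Finset.mem_univ i) (if_neg hi)

end Expansions

/-! ### Products of scalar series with vector-valued series -/

section Convolution

variable {σ G : Type} [AddCommGroup G] {U : Type*} [AddCommGroup U] [Module ℂ U]

/-- The product of a scalar series and a vector-valued series. -/
noncomputable def conv (c : G → ℂ) (F : G → U) : G → U := fun g => ∑ᶠ p, c p • F (g - p)

/-- The coefficients of the product of two series are finite sums. -/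
def ConvFinite (c : G → ℂ) (F : G → U) : Prop :=
  ∀ g, (Function.support fun p => c p • F (g - p)).Finite

theorem conv_single_zero [DecidableEq G] (F : G → U) : conv (Pi.single 0 1) F = F := by
  ext g
  rw [conv, finsum_eq_single _ 0 fun p hp => by rw [Pi.single_eq_of_ne hp, zero_smul]]
  simp

/-- The scalar series whose product with `F` exists. -/
def convFiniteLeft (F : G → U) : Submodule ℂ (G → ℂ) where
  carrier := {c | ConvFinite c F}
  zero_mem' := fun g => by simp
  add_mem' := fun {a b} ha hb g => ((ha g).union (hb g)).subset fun x hx => by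
    by_contra hc
    simp only [Set.mem_union, Function.mem_support, not_or, not_not] at hc
    simp [add_smul, hc.1, hc.2] at hx
  smul_mem' := fun t a ha g => (ha g).subset fun x hx => by
    contrapose! hx
    simp only [Function.mem_support, not_not] at hx ⊢
    rw [Pi.smul_apply, smul_assoc, hx, smul_zero]

/-- The series whose product with `c` exists. -/
def convFiniteRight (c : G → ℂ) : Submodule ℂ (G → U) where
  carrier := {F | ConvFinite c F}
  zero_mem' := fun g => by simp
  add_mem' := fun {a b} ha hb g => ((ha g).union (hb g)).subset fun x hx => by
    by_contra hc
    simp only [Set.mem_union, Function.mem_support, not_or, not_not] at hc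
    simp [smul_add, hc.1, hc.2] at hx
  smul_mem' := fun t a ha g => (ha g).subset fun x hx => by
    contrapose! hx
    simp only [Function.mem_support, not_not] at hx ⊢
    rw [Pi.smul_apply, smul_comm, hx, smul_zero]

theorem convFinite_polyEnd_left (e : σ → G) {c : G → ℂ} {F : G → U} (h : ConvFinite c F)
    (p : MvPolynomial σ ℂ) : ConvFinite (polyEnd e ℂ p c) F := by
  refine polyEnd_mem e (U := ℂ)
    (convFiniteLeft F) ?_ p c h
  intro s a ha g
  refine ((ha (g - e s)).image (· + e s)).subset fun x hx => ⟨x - e s, ?_, by simp⟩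
  rw [Function.mem_support, polyEnd_X] at hx
  rwa [Function.mem_support, sub_sub_sub_cancel_right]

theorem convFinite_polyEnd_right (e : σ → G) {c : G → ℂ} {F : G → U} (h : ConvFinite c F)
    (p : MvPolynomial σ ℂ) : ConvFinite c (polyEnd e U p F) := by
  refine polyEnd_mem e (U := U)
    (convFiniteRight c) ?_ p F h
  intro s a ha g
  refine (ha (g - e s)).subset fun x hx => ?_
  rw [Function.mem_support, polyEnd_X] at hx
  rwa [Function.mem_support, sub_right_comm]

/-- Products of formal series are not associative in general. Together with `conv_polyEnd_right`,
this lets a polynomial move from one factor to the other as soon as the product exists. -/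
theorem conv_polyEnd_left (e : σ → G) {c : G → ℂ} {F : G → U} (h : ConvFinite c F)
    (p : MvPolynomial σ ℂ) : conv (polyEnd e ℂ p c) F = polyEnd e U p (conv c F) := by
  refine polyEnd_comm (e := e) (e' := e)
    (convFiniteLeft F)
    (fun s a ha => convFinite_polyEnd_left e ha _) (fun c => conv c F) ?_ ?_ ?_ p c h
  · intro a ha b hb
    ext g
    simp only [conv, Pi.add_apply, add_smul]
    exact finsum_add_distrib (ha g) (hb g)
  · intro t a ha
    ext g
    simp only [conv, Pi.smul_apply, smul_assoc]
    exact (smul_finsum' t (ha g)).symm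
  · intro s a _
    ext g
    simp only [conv, polyEnd_X]
    exact finsum_eq_of_bijective (· - e s) (Equiv.subRight (e s)).bijective
      fun p => by rw [sub_sub_sub_cancel_right]

theorem conv_polyEnd_right (e : σ → G) {c : G → ℂ} {F : G → U} (h : ConvFinite c F)
    (p : MvPolynomial σ ℂ) : conv c (polyEnd e U p F) = polyEnd e U p (conv c F) := by
  refine polyEnd_comm (e := e) (e' := e)
    (convFiniteRight c)
    (fun s a ha => convFinite_polyEnd_right e ha _) (fun F => conv c F) ?_ ?_ ?_ p F h
  · intro a ha b hb
    ext g
    simp only [conv, Pi.add_apply, smul_add]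
    exact finsum_add_distrib (ha g) (hb g)
  · intro t a ha
    ext g
    simp only [conv, Pi.smul_apply]
    rw [smul_finsum' t (ha g)]
    simp only [smul_comm t]
  · intro s a _
    ext g
    simp only [conv, polyEnd_X]
    simp only [sub_right_comm g]

theorem mulSeries_apply {c : G → ℂ} {f : OpSeries G U} (h : ∀ w, ConvFinite c fun g => f g w)
    (g : G) (w : U) : mulSeries c f g w = conv c (fun g => f g w) g := by
  rw [mulSeries, dif_pos fun w => h w g]
  rfl

end Convolution

/-! ### Series with exponents bounded below -/

section BoundedSupport

variable {σ G H : Type} [AddCommGroup G] [AddCommGroup H] [Lattice H]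
  {U U' : Type*} [AddCommGroup U] [Module ℂ U] [AddCommGroup U'] [Module ℂ U']

/-- The series whose exponents have bounded below image under `π`. -/
def boundedSub (π : G →+ H) (U : Type*) [AddCommGroup U] [Module ℂ U] :
    Submodule ℂ (G → U) where
  carrier := {F | ∃ l, ∀ g, F g ≠ 0 → l ≤ π g}
  zero_mem' := ⟨0, fun g h => absurd rfl h⟩
  add_mem' := fun {F F'} ⟨l, hl⟩ ⟨l', hl'⟩ => ⟨l ⊓ l', fun g hg => by
    by_cases h : F g = 0
    · refine inf_le_right.trans (hl' g fun h' => hg ?_)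
      rw [Pi.add_apply, h, h', add_zero]
    · exact inf_le_left.trans (hl g h)⟩
  smul_mem' := fun c F ⟨l, hl⟩ => ⟨l, fun g hg => hl g fun h => hg (by
    rw [Pi.smul_apply, h, smul_zero])⟩

theorem polyEnd_mem_boundedSub [IsOrderedAddMonoid H] (e : σ → G) (π : G →+ H)
    (p : MvPolynomial σ ℂ) {F : G → U} (hF : F ∈ boundedSub π U) : polyEnd e U p F ∈ boundedSub π U := by
  refine polyEnd_mem e _ ?_ p F hF
  rintro s F ⟨l, hl⟩
  refine ⟨l + π (e s), fun g hg => ?_⟩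
  rw [polyEnd_X] at hg
  have := hl _ hg
  rwa [map_sub, le_sub_iff_add_le] at this

theorem IsLaurent.polyEnd [IsOrderedAddMonoid H] {F : H → U} (hF : IsLaurent F) (e : σ → H)
    (p : MvPolynomial σ ℂ) :
    IsLaurent (polyEnd e U p F) :=
  polyEnd_mem_boundedSub e (AddMonoidHom.id H) p hF

theorem IsLaurent.add {F F' : H → U} (hF : IsLaurent F) (hF' : IsLaurent F') :
    IsLaurent (F + F') :=
  (boundedSub (AddMonoidHom.id H) U).add_mem hF hF'

theorem IsLaurent.smul {F : H → U} (hF : IsLaurent F) (c : ℂ) : IsLaurent (c • F) :=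
  (boundedSub (AddMonoidHom.id H) U).smul_mem c hF

theorem IsLaurent.map {P : Type} [Preorder P] {F : P → U} (hF : IsLaurent F) (L : U →ₗ[ℂ] U') :
    IsLaurent fun g => L (F g) := by
  obtain ⟨l, hl⟩ := hF
  exact ⟨l, fun g hg => hl fun h => hg (by simp only [h, map_zero])⟩

theorem isLaurent_prod {H' : Type} [AddCommGroup H'] [Lattice H']
    {F : H × H' → U} (h : F ∈ boundedSub (AddMonoidHom.fst H H') U)
    (h' : F ∈ boundedSub (AddMonoidHom.snd H H') U) : IsLaurent F := by
  obtain ⟨l, hl⟩ := h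
  obtain ⟨l', hl'⟩ := h'
  exact ⟨(l, l'), fun g hg => ⟨hl g hg, hl' g hg⟩⟩

end BoundedSupport

/-! ### The substitution x = y + z, first without and then with poles along x = y -/

section Taylor

variable {n : ℕ} {U U' : Type*} [AddCommGroup U] [Module ℂ U] [AddCommGroup U'] [Module ℂ U']

/-- The substitution `F(x, y) ↦ F(y + z, y)`, expanded in nonnegative powers of `z`. The
exponents of `z` are in the first place. -/
noncomputable def taylor (F : Exp n × Exp n → U) : Exp n × Exp n → U := fun g =>
  ∑ᶠ r, vecChoose r g.1 • F (r, g.2 + g.1 - r)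

theorem taylor_eq_sum {F : Exp n × Exp n → U} {l : Exp n × Exp n} (hl : ∀ g, F g ≠ 0 → l ≤ g)
    (j b : Exp n) {s : Finset (Exp n)} (hs : Finset.Icc l.1 (b + j - l.2) ⊆ s) :
    taylor F (j, b) = ∑ r ∈ s, vecChoose r j • F (r, b + j - r) := by
  refine finsum_eq_sum_of_support_subset _ fun r hr => hs ?_
  have h := hl (r, b + j - r) fun h => hr (by simp only [h, smul_zero])
  exact Finset.mem_Icc.2 ⟨h.1, le_sub_comm.1 h.2⟩

theorem taylor_finite {F : Exp n × Exp n → U} (hF : IsLaurent F) (j b : Exp n) :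
    (Function.support fun r => vecChoose r j • F (r, b + j - r)).Finite := by
  obtain ⟨l, hl⟩ := hF
  refine (Finset.finite_toSet (Finset.Icc l.1 (b + j - l.2))).subset fun r hr => ?_
  have h := @hl (r, b + j - r) fun h => hr (by simp only [h, smul_zero])
  exact Finset.mem_coe.2 (Finset.mem_Icc.2 ⟨h.1, le_sub_comm.1 h.2⟩)

theorem taylor_add {F F' : Exp n × Exp n → U} (hF : IsLaurent F) (hF' : IsLaurent F') :
    taylor (F + F') = taylor F + taylor F' := by
  ext ⟨j, b⟩
  simp only [taylor, Pi.add_apply, smul_add]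
  exact finsum_add_distrib (taylor_finite hF j b) (taylor_finite hF' j b)

theorem taylor_smul (c : ℂ) {F : Exp n × Exp n → U} (hF : IsLaurent F) :
    taylor (c • F) = c • taylor F := by
  ext ⟨j, b⟩
  simp only [taylor, Pi.smul_apply]
  rw [smul_finsum' c (taylor_finite hF j b)]
  simp only [smul_comm c]

theorem taylor_map (L : U →ₗ[ℂ] U') {F : Exp n × Exp n → U} (hF : IsLaurent F)
    (g : Exp n × Exp n) : taylor (fun g => L (F g)) g = L (taylor F g) := by
  simp only [taylor]
  rw [← LinearMap.toAddMonoidHom_coe, AddMonoidHom.map_finsum _ (taylor_finite hF g.1 g.2)]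
  simp

theorem taylor_of_not_nonneg (F : Exp n × Exp n → U) {j : Exp n} (hj : ¬ 0 ≤ j) (b : Exp n) :
    taylor F (j, b) = 0 := by
  simp [taylor, vecChoose_eq_zero hj]

/-- The substitution `x ↦ y + z`, `y ↦ y` on polynomials. -/
noncomputable def taylorVars (n : ℕ) :
    MvPolynomial (Fin n ⊕ Fin n) ℂ →ₐ[ℂ] MvPolynomial (Fin n ⊕ Fin n) ℂ :=
  aeval (Sum.elim (fun l => X (Sum.inl l) + X (Sum.inr l)) (fun l => X (Sum.inr l)))

/-- Only the variables need checking. For x_l the claim is Pascal's rule after the reindexing r ↦ r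
+ 1 in the `l`-th coordinate; for y_l it is a shift of exponents. -/
theorem taylor_act₂ (p : MvPolynomial (Fin n ⊕ Fin n) ℂ) {F : Exp n × Exp n → U}
    (hF : IsLaurent F) : taylor (act₂ U p F) = act₂ U (taylorVars n p) (taylor F) := by
  refine polyEnd_intertwine (taylorVars n) (boundedSub (AddMonoidHom.id _) U)
    (fun s F hF => polyEnd_mem_boundedSub _ _ _ hF) taylor
    (fun F hF F' hF' => taylor_add hF hF') (fun c F hF => taylor_smul c hF) ?_ p F hF
  rintro (l | l) F hF
  · ext ⟨j, b⟩
    rw [taylorVars, aeval_X, Sum.elim_inl, map_add, LinearMap.add_apply, Pi.add_apply, polyEnd_X,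
      polyEnd_X]
    simp only [pairExp, Sum.elim_inl, Sum.elim_inr, Prod.mk_sub_mk, sub_zero, taylor, polyEnd_X]
    have h1 := taylor_finite hF j (b - Pi.single l 1)
    have h2 := taylor_finite hF (j - Pi.single l 1) b
    have e1 : ∀ r, b - Pi.single l 1 + j - r = b + j - (r + Pi.single l 1) := fun r => by abel
    have e2 : ∀ r, b + (j - Pi.single l 1) - r = b + j - (r + Pi.single l 1) := fun r => by abel
    simp only [e1, e2] at h1 h2 ⊢
    rw [← finsum_add_distrib h2 h1]
    refine (finsum_eq_of_bijective (· + Pi.single l 1) (Equiv.addRight _).bijective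
      fun r => ?_).symm
    rw [vecChoose_add_single, add_smul, add_sub_cancel_right, add_comm]
  · ext ⟨j, b⟩
    rw [taylorVars, aeval_X, Sum.elim_inr, polyEnd_X]
    simp only [pairExp, Sum.elim_inr, Prod.mk_sub_mk, sub_zero, taylor, polyEnd_X]
    simp only [sub_right_comm _ _ (Pi.single l 1 : Exp n), sub_add_eq_add_sub]

theorem taylorVars_diffPow (k : Fin n → ℕ) :
    taylorVars n (diffPow k) = ∏ l, X (Sum.inl l) ^ k l := by
  simp [taylorVars, diffPow]

theorem polyEnd_X_pow {σ G : Type} [AddCommGroup G] (e : σ → G) (s : σ) (k : ℕ) (F : G → U)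
    (g : G) : polyEnd e U (X s ^ k) F g = F (g - k • e s) := by
  induction k generalizing g with
  | zero => simp
  | succ k ih => rw [pow_succ', polyEnd_mul_apply, polyEnd_X, ih, succ_nsmul', sub_sub]

theorem polyEnd_prod_X_pow {σ G ι : Type} [AddCommGroup G] (e : σ → G) (v : ι → σ)
    (s : Finset ι) (k : ι → ℕ) (F : G → U) (g : G) :
    polyEnd e U (∏ l ∈ s, X (v l) ^ k l) F g = F (g - ∑ l ∈ s, k l • e (v l)) := by
  classical
  induction s using Finset.induction_on generalizing g with
  | empty => simp
  | insert l s hl ih =>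
    rw [Finset.prod_insert hl, Finset.sum_insert hl, polyEnd_mul_apply, polyEnd_X_pow, ih, sub_sub]

theorem taylor_act₂_diffPow (k : Fin n → ℕ) {F : Exp n × Exp n → U} (hF : IsLaurent F)
    (j b : Exp n) :
    taylor (act₂ U (diffPow k) F) (j, b) = taylor F (j - fun i => (k i : ℤ), b) := by
  rw [taylor_act₂ _ hF, taylorVars_diffPow, polyEnd_prod_X_pow]
  congr 1
  have : ∑ l, k l • pairExp n (Sum.inl l) = (fun i => (k i : ℤ), 0) := by
    ext i
    · simp [pairExp, Prod.fst_sum, Finset.sum_apply, Pi.single_apply]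
    · simp [pairExp, Prod.snd_sum]
  rw [this]; simp

/-- The series `F(x, y)` such that some `(x - y) ^ k F(x, y)` is a Laurent series. -/
def quasiLaurent (n : ℕ) (U : Type*) [AddCommGroup U] [Module ℂ U] :
    Submodule ℂ (Exp n × Exp n → U) where
  carrier := {F | ∃ k : ℕ, IsLaurent (act₂ U (diffPow fun _ => k) F)}
  zero_mem' := ⟨0, by rw [map_zero]; exact (boundedSub (AddMonoidHom.id _) U).zero_mem⟩
  add_mem' := fun {F F'} ⟨k, hk⟩ ⟨k', hk'⟩ => ⟨k + k', by
    rw [map_add]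
    refine IsLaurent.add ?_ ?_
    · rw [show (fun _ : Fin n => k + k') = (fun _ => k') + fun _ => k by ext; simp [add_comm],
        diffPow_add, polyEnd_mul_apply]
      exact hk.polyEnd _ _
    · rw [show (fun _ : Fin n => k + k') = (fun _ => k) + fun _ => k' by rfl,
        diffPow_add, polyEnd_mul_apply]
      exact hk'.polyEnd _ _⟩
  smul_mem' := fun c F ⟨k, hk⟩ => ⟨k, by rw [map_smul]; exact hk.smul c⟩

theorem IsLaurent.diffPow_mono {F : Exp n × Exp n → U} {k : ℕ}
    (hk : IsLaurent (act₂ U (diffPow fun _ => k) F)) {k' : ℕ} (h : k ≤ k') :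
    IsLaurent (act₂ U (diffPow fun _ => k') F) := by
  rw [show (fun _ : Fin n => k') = (fun _ => k' - k) + fun _ => k by ext; simp [h],
    diffPow_add, polyEnd_mul_apply]
  exact hk.polyEnd _ _

theorem act₂_mem_quasiLaurent (p : MvPolynomial (Fin n ⊕ Fin n) ℂ) {F : Exp n × Exp n → U}
    (hF : F ∈ quasiLaurent n U) : act₂ U p F ∈ quasiLaurent n U := by
  obtain ⟨k, hk⟩ := hF
  refine ⟨k, ?_⟩
  rw [← polyEnd_mul_apply, mul_comm, polyEnd_mul_apply]
  exact hk.polyEnd _ _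

theorem quasiLaurent_map {F : Exp n × Exp n → U} (hF : F ∈ quasiLaurent n U) (L : U →ₗ[ℂ] U') :
    (fun g => L (F g)) ∈ quasiLaurent n U' := by
  obtain ⟨k, hk⟩ := hF
  refine ⟨k, ?_⟩
  have := hk.map L
  simp only [polyEnd_map] at this
  exact this

open Classical in
/-- The substitution `F(x, y) ↦ F(y + z, y)` for series with poles along `x = y`: the
product of `z ^ (-k)` and the Taylor expansion of `(x - y) ^ k F(x, y)` at `x = y + z`. -/
noncomputable def expand (F : Exp n × Exp n → U) : Exp n × Exp n → U := fun g =>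
  if h : ∃ k : ℕ, IsLaurent (act₂ U (diffPow fun _ => k) F) then
    taylor (act₂ U (diffPow fun _ => h.choose) F) (g.1 + fun _ => (h.choose : ℤ), g.2)
  else 0

/-- Independence of the pole order: an additional factor (x - y)^d becomes z^d under the
substitution, which the shift of the z-exponent undoes. -/
theorem expand_eq {F : Exp n × Exp n → U} {k : ℕ}
    (hk : IsLaurent (act₂ U (diffPow fun _ => k) F)) (i b : Exp n) :
    expand F (i, b) = taylor (act₂ U (diffPow fun _ => k) F) (i + fun _ => (k : ℤ), b) := by
  have key : ∀ {m m' : ℕ}, IsLaurent (act₂ U (diffPow fun _ => m) F) → m ≤ m' →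
      taylor (act₂ U (diffPow fun _ => m') F) (i + fun _ => (m' : ℤ), b) =
      taylor (act₂ U (diffPow fun _ => m) F) (i + fun _ => (m : ℤ), b) := fun {m m'} hm h => by
    rw [show (fun _ : Fin n => m') = (fun _ => m' - m) + fun _ => m by ext; simp [h],
      diffPow_add, polyEnd_mul_apply, taylor_act₂_diffPow _ hm]
    congr 2
    ext
    simp only [Pi.add_apply, Pi.sub_apply]
    lia
  have h : ∃ k : ℕ, IsLaurent (act₂ U (diffPow fun _ => k) F) := ⟨k, hk⟩
  rw [expand, dif_pos h]
  rcases le_total k h.choose with h' | h'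
  · exact key hk h'
  · exact (key h.choose_spec h').symm

theorem expand_of_isLaurent {F : Exp n × Exp n → U} (hF : IsLaurent F) :
    expand F = taylor F := by
  ext ⟨i, b⟩
  have h0 : act₂ U (diffPow fun _ : Fin n => 0) F = F := by simp [diffPow]
  rw [expand_eq (k := 0) (by rwa [h0]), h0]
  congr 2
  ext; simp

theorem expand_add {F F' : Exp n × Exp n → U} (hF : F ∈ quasiLaurent n U)
    (hF' : F' ∈ quasiLaurent n U) : expand (F + F') = expand F + expand F' := by
  obtain ⟨k, hk⟩ := hF
  obtain ⟨k', hk'⟩ := hF'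
  ext ⟨i, b⟩
  have h1 := hk.diffPow_mono (le_max_left k k')
  have h2 := hk'.diffPow_mono (le_max_right k k')
  rw [Pi.add_apply, expand_eq h1, expand_eq h2, expand_eq (k := max k k'), map_add,
    taylor_add h1 h2, Pi.add_apply]
  rw [map_add]; exact h1.add h2

theorem expand_smul (c : ℂ) {F : Exp n × Exp n → U} (hF : F ∈ quasiLaurent n U) :
    expand (c • F) = c • expand F := by
  obtain ⟨k, hk⟩ := hF
  ext ⟨i, b⟩
  rw [Pi.smul_apply, expand_eq hk, expand_eq (k := k), map_smul, taylor_smul c hk, Pi.smul_apply]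
  rw [map_smul]; exact hk.smul c

theorem expand_map (L : U →ₗ[ℂ] U') {F : Exp n × Exp n → U} (hF : F ∈ quasiLaurent n U)
    (g : Exp n × Exp n) : expand (fun g => L (F g)) g = L (expand F g) := by
  obtain ⟨k, hk⟩ := hF
  have h : act₂ U' (diffPow fun _ => k) (fun g => L (F g)) =
      fun g => L (act₂ U (diffPow fun _ => k) F g) := by
    ext g; rw [polyEnd_map]
  obtain ⟨i, b⟩ := g
  rw [expand_eq hk, expand_eq (k := k), h, taylor_map L hk]
  rw [h]; exact hk.map L

theorem expand_act₂ (p : MvPolynomial (Fin n ⊕ Fin n) ℂ) {F : Exp n × Exp n → U}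
    (hF : F ∈ quasiLaurent n U) : expand (act₂ U p F) = act₂ U (taylorVars n p) (expand F) := by
  obtain ⟨k, hk⟩ := hF
  have hcomm : act₂ U (diffPow fun _ => k) (act₂ U p F) =
      act₂ U p (act₂ U (diffPow fun _ => k) F) := by
    rw [← polyEnd_mul_apply, mul_comm, polyEnd_mul_apply]
  have hshift : expand F = fun g =>
      taylor (act₂ U (diffPow fun _ => k) F) (g + (fun _ => (k : ℤ), 0)) := by
    ext ⟨i, b⟩
    rw [expand_eq hk]; simp
  rw [hshift, ← polyEnd_comm (e := pairExp n) (e' := pairExp n) ⊤ (fun _ _ _ => trivial)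
    (fun F g => F (g + (fun _ => (k : ℤ), 0))) (fun _ _ _ _ => rfl) (fun _ _ _ => rfl)
    (fun s F _ => by ext g; simp only [polyEnd_X]; congr 1; abel) _ _ trivial]
  ext ⟨i, b⟩
  rw [expand_eq (k := k), hcomm, taylor_act₂ p hk]
  · simp
  · rw [hcomm]; exact hk.polyEnd _ _

theorem le_of_expand_ne_zero {F : Exp n × Exp n → U} {k : ℕ}
    (hk : IsLaurent (act₂ U (diffPow fun _ => k) F)) {i b : Exp n} (h : expand F (i, b) ≠ 0) :
    (fun _ => -(k : ℤ)) ≤ i := by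
  rw [expand_eq hk] at h
  have := not_imp_comm.1 (taylor_of_not_nonneg _ · b) h
  intro l
  have := this l
  simp only [Pi.zero_apply, Pi.add_apply] at this
  dsimp only
  lia

theorem isLaurent_expand {F : Exp n × Exp n → U} (hF : F ∈ quasiLaurent n U) (i : Exp n) :
    IsLaurent fun b => expand F (i, b) := by
  obtain ⟨k, hk⟩ := hF
  obtain ⟨l, hl⟩ := id hk
  refine ⟨l.1 + l.2 - (i + fun _ => (k : ℤ)), fun b hb => ?_⟩
  rw [Function.mem_support, expand_eq hk, taylor_eq_sum (fun g hg => hl hg) _ _ subset_rfl] at hb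
  obtain ⟨r, hr, -⟩ := Finset.exists_ne_zero_of_sum_ne_zero hb
  rw [Finset.mem_Icc] at hr
  have := hr.1.trans hr.2
  rw [sub_le_iff_le_add]
  exact (le_sub_iff_add_le.1 this)

end Taylor

theorem finsum_eq_sum_image {α β M : Type*} [AddCommMonoid M] {f : α → M} {e : β → α}
    (he : Function.Injective e) {s : Finset β} (h : ∀ x, f x ≠ 0 → ∃ t ∈ s, e t = x) :
    ∑ᶠ x, f x = ∑ t ∈ s, f (e t) := by
  classical
  rw [finsum_eq_sum_of_support_subset (s := s.image e) _ fun x hx => by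
    simpa using h x hx, Finset.sum_image fun _ _ _ _ h => he h]

/-! ### Iota-maps, the products ψ_m φ and the Jacobi identity -/

section Products

variable {n : ℕ} {W : Type*} [AddCommGroup W] [Module ℂ W]

/-- The series `ψ(x) φ(y) w`. -/
def pairSeries (ψ φ : OpSeries (Exp n) W) (w : W) : Exp n × Exp n → W := fun g => ψ g.1 (φ g.2 w)

theorem mulSeries_subPow_natCast (k : ℕ) (f : OpSeries (Exp n × Exp n) W) (g : Exp n × Exp n)
    (w : W) : mulSeries (subPow 0 (k : Exp n)) f g w =
      act₂ W (diffPow fun _ => k) (fun g => f g w) g := by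
  have hfin : ∀ w, ConvFinite (Pi.single 0 1) fun g => f g w := fun w g =>
    (Set.finite_singleton 0).subset fun p hp => by
      by_contra h
      exact hp (by simp only [Pi.single_eq_of_ne (show p ≠ 0 from h), zero_smul])
  have hk : subPow 0 (k : Exp n) = act₂ ℂ (diffPow fun _ => k) (Pi.single 0 1) :=
    subPow_natCast 0 fun _ => k
  rw [hk, mulSeries_apply fun w => convFinite_polyEnd_left _ (hfin w) _,
    conv_polyEnd_left _ (hfin w), conv_single_zero]

theorem clearsPole_iff {k : ℕ} {f : OpSeries (Exp n × Exp n) W} :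
    ClearsPole k f ↔ ∀ w, IsLaurent (act₂ W (diffPow fun _ => k) fun g => f g w) := by
  simp only [ClearsPole, mulSeries_subPow_natCast]

theorem mutuallyLocal_iff {ψ φ : OpSeries (Exp n) W} : MutuallyLocal ψ φ ↔
    ∃ k : ℕ, ∀ w, act₂ W (diffPow fun _ => k) (pairSeries ψ φ w) =
      act₂ W (diffPow fun _ => k) fun g => φ g.2 (ψ g.1 w) := by
  refine exists_congr fun k => ⟨fun h w => ?_, fun h => ?_⟩
  · ext g
    have := congrArg (fun f => f g w) h
    simp only [mulSeries_subPow_natCast] at this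
    exact this
  · ext g w
    simp only [mulSeries_subPow_natCast]
    exact congrFun (h w) g

theorem pairSeries_mem_boundedSub {φ : OpSeries (Exp n) W} (ψ : OpSeries (Exp n) W)
    (hφ : φ ∈ VO n W) (w : W) :
    pairSeries ψ φ w ∈ boundedSub (AddMonoidHom.snd (Exp n) (Exp n)) W := by
  obtain ⟨l, hl⟩ := hφ w
  exact ⟨l, fun g hg => hl fun h => hg (by
    have h : φ g.2 w = 0 := h
    rw [pairSeries, h, map_zero])⟩

/-- In ψ(x)φ(y)w the exponents of y are bounded below, in φ(y)ψ(x)w those of x; after multiplication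
by (x - y)^k the two series coincide, so both bounds hold. The exponent k serves all w. -/
theorem MutuallyLocal.isLaurent {ψ φ : OpSeries (Exp n) W} (h : MutuallyLocal ψ φ)
    (hψ : ψ ∈ VO n W) (hφ : φ ∈ VO n W) :
    ∃ k : ℕ, ∀ w, IsLaurent (act₂ W (diffPow fun _ => k) (pairSeries ψ φ w)) := by
  obtain ⟨k, hk⟩ := mutuallyLocal_iff.1 h
  refine ⟨k, fun w => isLaurent_prod ?_
    (polyEnd_mem_boundedSub _ _ _ (pairSeries_mem_boundedSub ψ hφ w))⟩
  rw [hk]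
  refine polyEnd_mem_boundedSub _ _ _ ?_
  obtain ⟨l, hl⟩ := hψ w
  exact ⟨l, fun g hg => hl fun h => hg (by
    have h : ψ g.1 w = 0 := h
    simp only [h, map_zero])⟩

theorem convFinite_subPow_zero (m : Exp n) {F : Exp n × Exp n → W}
    (hF : F ∈ boundedSub (AddMonoidHom.snd (Exp n) (Exp n)) W) : ConvFinite (subPow 0 m) F := by
  obtain ⟨l, hl⟩ := hF
  intro g
  refine ((Finset.Icc 0 (g.2 - l)).finite_toSet.image fun q => (m - q, q)).subset fun p hp => ?_
  rw [Function.mem_support, smul_ne_zero_iff] at hp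
  refine ⟨p.2, ?_, Prod.ext ?_ rfl⟩
  · rw [Finset.mem_coe, Finset.mem_Icc]
    exact ⟨not_imp_comm.1 subPow_zero_eq_zero hp.1, le_sub_comm.1 (hl _ hp.2)⟩
  · exact (eq_sub_of_add_eq (not_imp_comm.1 subPow_eq_zero hp.1)).symm

theorem convFinite_subPow (α : Fin n → ZMod 2) (m : Exp n) {F : Exp n × Exp n → W}
    (hF : IsLaurent F) : ConvFinite (subPow α m) F := by
  obtain ⟨l, hl⟩ := hF
  intro g
  refine ((Finset.Icc (m - (g.2 - l.2)) (g.1 - l.1)).finite_toSet.image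
    fun p => (p, m - p)).subset fun p hp => ?_
  rw [Function.mem_support, smul_ne_zero_iff] at hp
  have h := hl hp.2
  have h' : p.1 + p.2 = m := not_imp_comm.1 subPow_eq_zero hp.1
  refine ⟨p.1, ?_, Prod.ext rfl (eq_sub_of_add_eq' h').symm⟩
  rw [Finset.mem_coe, Finset.mem_Icc]
  refine ⟨?_, le_sub_comm.1 h.1⟩
  rw [← h', sub_le_iff_le_add, add_le_add_iff_left]
  exact le_sub_comm.1 h.2

theorem conv_subPow_eq_sum (α : Fin n → ZMod 2) (j : Exp n) {F : Exp n × Exp n → W}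
    {l : Exp n × Exp n} (hl : ∀ g, F g ≠ 0 → l ≤ g) (a b : Exp n) :
    conv (subPow α (-j - 1)) F (a, b) = ∑ r ∈ Finset.Icc l.1 (a + b + j + 1 - l.2),
      subPow α (-j - 1) (a - r, r - a - j - 1) • F (r, a + b + j + 1 - r) := by
  rw [conv, finsum_eq_sum_image (e := fun r => (a - r, r - a - j - 1))
    (s := Finset.Icc l.1 (a + b + j + 1 - l.2))]
  · refine Finset.sum_congr rfl fun r _ => ?_
    rw [Prod.mk_sub_mk, sub_sub_cancel,
      show b - (r - a - j - 1) = a + b + j + 1 - r by abel]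
  · intro r r' h
    exact sub_right_injective (Prod.ext_iff.1 h).1
  · intro p hp
    rw [smul_ne_zero_iff] at hp
    have h := hl _ hp.2
    have h' : p.1 + p.2 = -j - 1 := not_imp_comm.1 subPow_eq_zero hp.1
    have h'' : p.2 = -j - 1 - p.1 := eq_sub_of_add_eq' h'
    refine ⟨a - p.1, Finset.mem_Icc.2 ⟨h.1, ?_⟩, Prod.ext (sub_sub_cancel _ _) ?_⟩
    · rw [le_sub_comm, show a + b + j + 1 - (a - p.1) = b - p.2 by rw [h'']; abel]
      exact h.2
    · dsimp only; rw [h'']; abel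

/-- This frees `iota` from its chosen exponent: any `K` clearing the pole of ψ(x)φ(y) may be used,
and (x - y)^m merges with the expanded power. -/
theorem iota_apply {ψ φ : OpSeries (Exp n) W} (hφ : φ ∈ VO n W) {K : ℕ}
    (hK : ∀ w, IsLaurent (act₂ W (diffPow fun _ => K) (pairSeries ψ φ w)))
    (α : Fin n → ZMod 2) (m : Exp n) (g : Exp n × Exp n) (w : W) :
    iota α (mulSeries (subPow 0 m) (prodXY ψ φ)) g w =
      conv (subPow α (m - fun _ => (K : ℤ)))
        (act₂ W (diffPow fun _ => K) (pairSeries ψ φ w)) g := by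
  have hfin : ∀ m w, ConvFinite (subPow 0 m) (pairSeries ψ φ w) := fun m w =>
    convFinite_subPow_zero m (pairSeries_mem_boundedSub ψ hφ w)
  have hmul : ∀ w, (fun g => mulSeries (subPow 0 m) (prodXY ψ φ) g w) =
      conv (subPow 0 m) (pairSeries ψ φ w) := fun w => by
    ext g; exact mulSeries_apply (hfin m) g w
  have hconv : ∀ (k : Fin n → ℕ) (m : Exp n) w,
      act₂ W (diffPow k) (conv (subPow 0 m) (pairSeries ψ φ w)) =
      conv (subPow 0 (m + fun i => (k i : ℤ))) (pairSeries ψ φ w) := fun k m w => by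
    rw [← conv_polyEnd_left _ (hfin m w), act₂_diffPow_subPow]
  have hred : ∀ (k : Exp n) w, (fun _ => (K : ℤ)) ≤ k → ∃ k' : Fin n → ℕ,
      (fun i => (k' i : ℤ)) = k - (fun _ => (K : ℤ)) ∧
      conv (subPow 0 k) (pairSeries ψ φ w) =
        act₂ W (diffPow k') (act₂ W (diffPow fun _ => K) (pairSeries ψ φ w)) := fun k w h => by
    have h0 : (fun i => (((k i - K).toNat : ℕ) : ℤ)) = k - fun _ => (K : ℤ) := by
      ext i
      have := h i
      dsimp only at this
      simp only [Pi.sub_apply]; lia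
    refine ⟨fun i => (k i - K).toNat, h0, ?_⟩
    have h1 := hconv (fun _ => K) 0 w
    rw [subPow_zero, conv_single_zero] at h1
    rw [h1, hconv, h0, zero_add, add_sub_cancel]
  have hex : ∃ k : ℕ, ClearsPole k (mulSeries (subPow 0 m) (prodXY ψ φ)) := by
    -- The sum is a single exponent that is at least K - m_i for every coordinate i.
    refine ⟨∑ i, (K - m i).toNat, clearsPole_iff.2 fun w => ?_⟩
    rw [hmul, hconv]
    obtain ⟨k', -, h⟩ := hred (m + fun _ => ((∑ i, (K - m i).toNat : ℕ) : ℤ)) w fun i => by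
      have := Finset.single_le_sum (f := fun i => (K - m i).toNat) (fun _ _ => Nat.zero_le _)
        (Finset.mem_univ i)
      simp only [Pi.add_apply] at this ⊢
      lia
    rw [h]
    exact (hK w).polyEnd _ _
  rw [iota, dif_pos hex]
  have hk := clearsPole_iff.1 hex.choose_spec
  generalize hex.choose = k at hk
  have hk' : ∀ w, IsLaurent fun g =>
      mulSeries (subPow 0 (k : Exp n)) (mulSeries (subPow 0 m) (prodXY ψ φ)) g w := fun w => by
    simp only [mulSeries_subPow_natCast]; exact hk w
  rw [mulSeries_apply fun w => convFinite_subPow α _ (hk' w)]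
  simp only [mulSeries_subPow_natCast]
  have hk := hk w
  rw [hmul w] at hk ⊢
  -- The chosen `k` need not satisfy m + k ≥ K. An auxiliary factor (x - y)^L, split off from the
  -- expansion of (x - y)^(-k) and moved to the other factor, makes the comparison with `K`
  -- possible.
  obtain ⟨L, hL⟩ : ∃ L : ℕ, (fun _ => (K : ℤ)) ≤ m + (fun _ => (k : ℤ)) + fun _ => (L : ℤ) := by
    refine ⟨∑ i, (K - m i).toNat, fun i => ?_⟩
    have := Finset.single_le_sum (f := fun i => (K - m i).toNat) (fun _ _ => Nat.zero_le _)
      (Finset.mem_univ i)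
    simp only [Pi.add_apply] at this ⊢
    lia
  obtain ⟨k', hk', h⟩ := hred _ w hL
  have hsub : subPow α (-(k : Exp n)) =
      act₂ ℂ (diffPow fun _ => L) (subPow α (-(fun _ => (k : ℤ)) - fun _ => (L : ℤ))) := by
    rw [act₂_diffPow_subPow, sub_add_cancel]; rfl
  rw [hsub, conv_polyEnd_left _ (convFinite_subPow α _ hk),
    ← conv_polyEnd_right _ (convFinite_subPow α _ hk), hconv, hconv, h,
    conv_polyEnd_right _ (convFinite_subPow α _ (hK w)),
    ← conv_polyEnd_left _ (convFinite_subPow α _ (hK w)), act₂_diffPow_subPow, hk']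
  congr 2; abel

/-- After the pole is cleared, all `α` act on the same Laurent series, so the signed expansions can
be summed first by `sum_sign_subPow`. Here -j - 1 = m - K is the remaining exponent of x - y. -/
theorem iotaSum_apply {ψ φ : OpSeries (Exp n) W} (hφ : φ ∈ VO n W) {K : ℕ}
    (hK : ∀ w, IsLaurent (act₂ W (diffPow fun _ => K) (pairSeries ψ φ w)))
    (m : Exp n) {j : Exp n} (hj : j = (fun _ => (K : ℤ)) - m - 1) (a b : Exp n) (w : W)
    {l : Exp n × Exp n}
    (hl : ∀ g, act₂ W (diffPow fun _ => K) (pairSeries ψ φ w) g ≠ 0 → l ≤ g) :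
    iotaSum ψ φ m (a, b) w = ∑ r ∈ Finset.Icc l.1 (a + b + j + 1 - l.2),
      vecChoose (-a - 1 + r) j •
        act₂ W (diffPow fun _ => K) (pairSeries ψ φ w) (r, a + b + j + 1 - r) := by
  have hm : (m - fun _ => (K : ℤ)) = -j - 1 := by rw [hj]; abel
  simp only [iotaSum, Finset.sum_apply, Pi.smul_apply, LinearMap.sum_apply, LinearMap.smul_apply,
    iota_apply hφ hK, hm, conv_subPow_eq_sum _ j hl, Finset.smul_sum, smul_smul]
  rw [Finset.sum_comm]
  refine Finset.sum_congr rfl fun r _ => ?_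
  rw [← Finset.sum_smul, sum_sign_subPow, if_pos (by dsimp only; abel)]
  rw [show -(a - r) - 1 = -a - 1 + r by abel, show -(-j - 1) - 1 = j by abel]

/-- At a = -1 the coefficient in `iotaSum_apply` is `vecChoose r j`, which is exactly the Taylor
coefficient of x^r at x = y + z. -/
theorem nthProd_apply {ψ φ : OpSeries (Exp n) W} (hφ : φ ∈ VO n W) {K : ℕ}
    (hK : ∀ w, IsLaurent (act₂ W (diffPow fun _ => K) (pairSeries ψ φ w)))
    (m b : Exp n) (w : W) :
    nthProd ψ m φ b w = expand (pairSeries ψ φ w) (-m - 1, b) := by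
  obtain ⟨l, hl⟩ := id (hK w)
  rw [nthProd, iotaSum_apply hφ hK m rfl (-1) b w fun g hg => hl hg, expand_eq (hK w),
    taylor_eq_sum (fun g hg => hl hg) _ _ subset_rfl]
  have e : (fun _ : Fin n => (K : ℤ)) - m - 1 = -m - 1 + fun _ => (K : ℤ) := by abel
  rw [e]
  generalize (-m - 1 + fun _ : Fin n => (K : ℤ)) = j
  have e' : -1 + b + j + 1 = b + j := by abel
  simp only [e', neg_neg, sub_self, zero_add]

/-- For each r, the right side carries the binomial coefficient of (-a - 1) + r over c + K.
Vandermonde splits it into the coefficients of (x - z)^(a + t), from the delta series, times the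
Taylor coefficients of the iterate. -/
theorem jacobiIdentity_of_nthProd {V : Type*} [AddCommGroup V] [Module ℂ V]
    {Y : V → OpSeries (Exp n) V} {YW : V → OpSeries (Exp n) W} {u v : V} (hv : YW v ∈ VO n W)
    {K : ℕ} (hK : ∀ w, IsLaurent (act₂ W (diffPow fun _ => K) (pairSeries (YW u) (YW v) w)))
    (h : ∀ c, YW (Y u c v) = nthProd (YW u) (-c - 1) (YW v)) : JacobiIdentity Y YW u v := by
  intro a b c
  ext w
  have hit : ∀ w g, iterate Y YW u v g w =
      if g.1 = 0 then expand (pairSeries (YW u) (YW v) w) (g.2.2, g.2.1) else 0 := fun w g => by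
    rw [iterate]
    split_ifs
    · rw [h, nthProd_apply hv hK]
      congr 2; abel
    · rfl
  -- The iterate does not involve x, so the delta series must supply the whole x-exponent; its
  -- z-exponent t then determines the y-exponent. The pole order bounds t above.
  have hsupp : ∀ w (g p : Exp n × Exp n × Exp n), deltaXZY p • iterate Y YW u v (g - p) w ≠ 0 →
      ∃ t ∈ Finset.Icc 0 (g.2.2 + fun _ => (K : ℤ)), (g.1, -g.1 - t - 1, t) = p := by
    intro w g p hp
    rw [hit, smul_ne_zero_iff, Ne, Ne, ite_eq_right_iff, Classical.not_imp] at hp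
    obtain ⟨h1, h2, h3⟩ := hp
    have h2 : g.1 = p.1 := sub_eq_zero.1 h2
    have h3 := le_of_expand_ne_zero (hK w) h3
    have h4 : 0 ≤ p.2.2 := not_imp_comm.1 (subPow_zero_eq_zero (p := (p.1, p.2.2))) h1
    have h5 : p.1 + p.2.2 = -p.2.1 - 1 :=
      not_imp_comm.1 (subPow_eq_zero (p := (p.1, p.2.2))) h1
    refine ⟨p.2.2, Finset.mem_Icc.2 ⟨h4, ?_⟩, Prod.ext h2 (Prod.ext ?_ rfl)⟩
    · have h3 : -(fun _ => (K : ℤ)) ≤ g.2.2 - p.2.2 := h3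
      rwa [neg_le_iff_add_nonneg, ← add_sub_right_comm, sub_nonneg] at h3
    · change -g.1 - p.2.2 - 1 = p.2.1
      rw [h2, show -p.1 - p.2.2 - 1 = -(p.1 + p.2.2) - 1 by abel, h5]; abel
  have hinj : ∀ a : Exp n, Function.Injective fun t : Exp n => (a, -a - t - 1, t) :=
    fun a t t' h => (Prod.ext_iff.1 (Prod.ext_iff.1 h).2).2
  have hfin : ∀ w, ConvFinite deltaXZY fun g => iterate Y YW u v g w := fun w g =>
    ((Finset.finite_toSet _).image _).subset fun p hp => hsupp w g p hp
  obtain ⟨l, hl⟩ := id (hK w)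
  rw [mulSeries_apply hfin, conv, finsum_eq_sum_image (hinj a) (hsupp w (a, b, c)),
    iotaSum_apply hv hK (-c - 1) (j := c + fun _ => (K : ℤ)) (by abel) a b w fun g hg => hl hg]
  simp only [hit, Prod.fst_sub, Prod.snd_sub, sub_self, if_true, vecChoose_add, Finset.sum_smul]
  rw [Finset.sum_comm]
  refine Finset.sum_congr rfl fun t _ => ?_
  rw [expand_eq (hK w), taylor_eq_sum (fun g hg => hl hg) _ _ subset_rfl, Finset.smul_sum]
  have e1 : b - (-a - t - 1) + (c - t + fun _ => (K : ℤ)) = a + b + (c + fun _ => (K : ℤ)) + 1 := by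
    abel
  have e2 : c - t + (fun _ => (K : ℤ)) = (c + fun _ => (K : ℤ)) - t := by abel
  have e3 : deltaXZY (a, -a - t - 1, t) = vecChoose (-a - 1) t := by
    rw [deltaXZY, ← subPow_zero_add]
    congr 1; dsimp only; abel
  rw [e1, e2, e3]
  exact Finset.sum_congr rfl fun r _ => smul_smul _ _ _

end Products

/-- Fixing the exponents of the variables not involved, or permuting variables, reduces the action
of a renamed polynomial to the original action. -/
theorem polyEnd_rename_comp {σ τ G G' : Type} [AddCommGroup G] [AddCommGroup G'] {U : Type*}
    [AddCommGroup U] [Module ℂ U] {e : σ → G} {e' : τ → G'} (v : τ → σ) (ι : G' → G)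
    (hι : ∀ g s, ι (g - e' s) = ι g - e (v s)) (q : MvPolynomial τ ℂ) (F : G → U) (g : G') :
    polyEnd e U (rename v q) F (ι g) = polyEnd e' U q (fun g => F (ι g)) g := by
  induction q using MvPolynomial.induction_on generalizing F g with
  | C a => rw [rename_C, polyEnd_C, polyEnd_C]; rfl
  | add p q hp hq =>
    simp only [map_add, LinearMap.add_apply, Pi.add_apply, hp, hq]
  | mul_X p s hp =>
    rw [map_mul, rename_X, polyEnd_mul_apply, polyEnd_mul_apply, hp]
    refine congrFun (congrArg _ (funext fun g => ?_)) g
    rw [polyEnd_X, polyEnd_X, hι]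

/-! ### Iterated substitutions in three sets of variables -/

section ThreeVariables

variable {n : ℕ} {U : Type*} [AddCommGroup U] [Module ℂ U]

/-- The exponents of the variables of series in three sets of variables. -/
def tripleExp (n : ℕ) : Fin n ⊕ Fin n ⊕ Fin n → Exp n × Exp n × Exp n :=
  Sum.elim (fun l => (Pi.single l 1, 0, 0))
    (Sum.elim (fun l => (0, Pi.single l 1, 0)) (fun l => (0, 0, Pi.single l 1)))

/-- Multiplication of series in three sets of variables by polynomials. -/
noncomputable abbrev act₃ (U : Type*) [AddCommGroup U] [Module ℂ U] :
    MvPolynomial (Fin n ⊕ Fin n ⊕ Fin n) ℂ →ₐ[ℂ] Module.End ℂ (Exp n × Exp n × Exp n → U) :=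
  polyEnd (tripleExp n) U

/-- The first set of variables. -/
noncomputable abbrev var₁ (l : Fin n) : MvPolynomial (Fin n ⊕ Fin n ⊕ Fin n) ℂ := X (Sum.inl l)

/-- The second set of variables. -/
noncomputable abbrev var₂ (l : Fin n) : MvPolynomial (Fin n ⊕ Fin n ⊕ Fin n) ℂ :=
  X (Sum.inr (Sum.inl l))

/-- The third set of variables. -/
noncomputable abbrev var₃ (l : Fin n) : MvPolynomial (Fin n ⊕ Fin n ⊕ Fin n) ℂ :=
  X (Sum.inr (Sum.inr l))

/-- The substitution `expand` in two of three sets of variables; `ε` tells which. -/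
noncomputable def expandAlong (ε : (Exp n × Exp n) × Exp n ≃+ Exp n × Exp n × Exp n)
    (F : Exp n × Exp n × Exp n → U) : Exp n × Exp n × Exp n → U := fun g =>
  expand (fun p => F (ε (p, (ε.symm g).2))) (ε.symm g).1

/-- The series on which `expandAlong ε` is defined. -/
def quasiAlong (ε : (Exp n × Exp n) × Exp n ≃+ Exp n × Exp n × Exp n) (U : Type*)
    [AddCommGroup U] [Module ℂ U] : Submodule ℂ (Exp n × Exp n × Exp n → U) where
  carrier := {F | ∀ c, (fun p => F (ε (p, c))) ∈ quasiLaurent n U}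
  zero_mem' := fun _ => (quasiLaurent n U).zero_mem
  add_mem' := fun h h' c => (quasiLaurent n U).add_mem (h c) (h' c)
  smul_mem' := fun t _ h c => (quasiLaurent n U).smul_mem t (h c)

/-- Here `v` embeds the two sets of variables taking part in the substitution, `u` the remaining
set, and `θ` is the induced substitution on polynomials. The new variable keeps the place of the one
it replaces. -/
theorem expandAlong_act₃ {ε : (Exp n × Exp n) × Exp n ≃+ Exp n × Exp n × Exp n}
    {v : Fin n ⊕ Fin n → Fin n ⊕ Fin n ⊕ Fin n} {u : Fin n → Fin n ⊕ Fin n ⊕ Fin n}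
    (hv : ∀ s, ε (pairExp n s, 0) = tripleExp n (v s))
    (hu : ∀ l, ε (0, Pi.single l 1) = tripleExp n (u l))
    (hvu : ∀ s, (∃ s', v s' = s) ∨ ∃ l, u l = s)
    {θ : MvPolynomial (Fin n ⊕ Fin n ⊕ Fin n) ℂ →ₐ[ℂ] MvPolynomial (Fin n ⊕ Fin n ⊕ Fin n) ℂ}
    (hθv : ∀ s, θ (X (v s)) = rename v (taylorVars n (X s)))
    (hθu : ∀ l, θ (X (u l)) = X (u l)) (p : MvPolynomial (Fin n ⊕ Fin n ⊕ Fin n) ℂ)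
    {F : Exp n × Exp n × Exp n → U} (hF : F ∈ quasiAlong ε U) :
    act₃ U p F ∈ quasiAlong ε U ∧
      expandAlong ε (act₃ U p F) = act₃ U (θ p) (expandAlong ε F) := by
  have hslice : ∀ (c : Exp n) (q : MvPolynomial (Fin n ⊕ Fin n) ℂ)
      (F : Exp n × Exp n × Exp n → U), (fun p => act₃ U (rename v q) F (ε (p, c))) =
        act₂ U q fun p => F (ε (p, c)) := fun c q F => by
    ext p
    refine polyEnd_rename_comp v (fun p => ε (p, c)) (fun g s => ?_) q F p
    rw [← hv, ← map_sub, show (g, c) - (pairExp n s, 0) = (g - pairExp n s, c - 0) from rfl,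
      sub_zero]
  have hslice' : ∀ (c : Exp n) (l : Fin n) (F : Exp n × Exp n × Exp n → U),
      (fun p => act₃ U (X (u l)) F (ε (p, c))) = fun p => F (ε (p, c - Pi.single l 1)) :=
    fun c l F => by
      ext p
      rw [polyEnd_X, ← hu, ← map_sub, Prod.mk_sub_mk, sub_zero]
  have hmem : ∀ s, ∀ F ∈ quasiAlong ε U, act₃ U (X s) F ∈ quasiAlong ε U := by
    intro s F hF c
    rcases hvu s with ⟨s, rfl⟩ | ⟨l, rfl⟩
    · rw [← rename_X v, hslice]
      exact act₂_mem_quasiLaurent _ (hF c)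
    · rw [hslice']
      exact hF _
  have happly : ∀ (F : Exp n × Exp n × Exp n → U) (p : Exp n × Exp n) (c : Exp n),
      expandAlong ε F (ε (p, c)) = expand (fun p => F (ε (p, c))) p := fun F p c => by
    simp only [expandAlong, AddEquiv.symm_apply_apply]
  refine ⟨polyEnd_mem _ _ hmem p F hF, ?_⟩
  refine polyEnd_intertwine θ (quasiAlong ε U) hmem (expandAlong ε) ?_ ?_ ?_ p F hF
  · intro F hF F' hF'
    ext g
    exact congrFun (expand_add (hF _) (hF' _)) _
  · intro c F hF
    ext g
    exact congrFun (expand_smul c (hF _)) _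
  · intro s F hF
    ext g
    obtain ⟨⟨p, c⟩, rfl⟩ := ε.surjective g
    rcases hvu s with ⟨s, rfl⟩ | ⟨l, rfl⟩
    · rw [hθv, happly, ← rename_X v, hslice, expand_act₂ _ (hF c)]
      have := congrFun (hslice c (taylorVars n (X s)) (expandAlong ε F)) p
      simp only [happly] at this
      exact this.symm
    · rw [hθu, happly, hslice']
      have := congrFun (hslice' c l (expandAlong ε F)) p
      simp only [happly] at this
      exact this.symm

/-- The first and second of three places. -/
def place₁₂ (n : ℕ) : (Exp n × Exp n) × Exp n ≃+ Exp n × Exp n × Exp n where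
  toFun g := (g.1.1, g.1.2, g.2)
  invFun g := ((g.1, g.2.1), g.2.2)
  map_add' _ _ := rfl

/-- The first and third of three places. -/
def place₁₃ (n : ℕ) : (Exp n × Exp n) × Exp n ≃+ Exp n × Exp n × Exp n where
  toFun g := (g.1.1, g.2, g.1.2)
  invFun g := ((g.1, g.2.2), g.2.1)
  map_add' _ _ := rfl

/-- The second and third of three places. -/
def place₂₃ (n : ℕ) : (Exp n × Exp n) × Exp n ≃+ Exp n × Exp n × Exp n where
  toFun g := (g.2, g.1.1, g.1.2)
  invFun g := ((g.2.1, g.2.2), g.1)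
  map_add' _ _ := rfl

/-- The substitution `x ↦ y + x` on polynomials in `x, y, z`. -/
noncomputable def subst₁₂ (n : ℕ) :
    MvPolynomial (Fin n ⊕ Fin n ⊕ Fin n) ℂ →ₐ[ℂ] MvPolynomial (Fin n ⊕ Fin n ⊕ Fin n) ℂ :=
  aeval (Sum.elim (fun l => var₁ l + var₂ l) (Sum.elim var₂ var₃))

/-- The substitution `x ↦ z + x` on polynomials in `x, y, z`. -/
noncomputable def subst₁₃ (n : ℕ) :
    MvPolynomial (Fin n ⊕ Fin n ⊕ Fin n) ℂ →ₐ[ℂ] MvPolynomial (Fin n ⊕ Fin n ⊕ Fin n) ℂ :=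
  aeval (Sum.elim (fun l => var₁ l + var₃ l) (Sum.elim var₂ var₃))

/-- The substitution `y ↦ z + y` on polynomials in `x, y, z`. -/
noncomputable def subst₂₃ (n : ℕ) :
    MvPolynomial (Fin n ⊕ Fin n ⊕ Fin n) ℂ →ₐ[ℂ] MvPolynomial (Fin n ⊕ Fin n ⊕ Fin n) ℂ :=
  aeval (Sum.elim var₁ (Sum.elim (fun l => var₂ l + var₃ l) var₃))

theorem expand₁₂_act₃ (p : MvPolynomial (Fin n ⊕ Fin n ⊕ Fin n) ℂ)
    {F : Exp n × Exp n × Exp n → U} (hF : F ∈ quasiAlong (place₁₂ n) U) :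
    act₃ U p F ∈ quasiAlong (place₁₂ n) U ∧ expandAlong (place₁₂ n) (act₃ U p F) =
      act₃ U (subst₁₂ n p) (expandAlong (place₁₂ n) F) :=
  expandAlong_act₃ (v := Sum.map id Sum.inl) (u := Sum.inr ∘ Sum.inr)
    (by rintro (l | l) <;> rfl) (fun _ => rfl)
    (by rintro (l | l | l)
        exacts [.inl ⟨.inl l, rfl⟩, .inl ⟨.inr l, rfl⟩, .inr ⟨l, rfl⟩])
    (by rintro (l | l) <;> simp [subst₁₂, taylorVars]) (fun l => by simp [subst₁₂]) p hF

theorem expand₁₃_act₃ (p : MvPolynomial (Fin n ⊕ Fin n ⊕ Fin n) ℂ)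
    {F : Exp n × Exp n × Exp n → U} (hF : F ∈ quasiAlong (place₁₃ n) U) :
    act₃ U p F ∈ quasiAlong (place₁₃ n) U ∧ expandAlong (place₁₃ n) (act₃ U p F) =
      act₃ U (subst₁₃ n p) (expandAlong (place₁₃ n) F) :=
  expandAlong_act₃ (v := Sum.map id Sum.inr) (u := Sum.inr ∘ Sum.inl)
    (by rintro (l | l) <;> rfl) (fun _ => rfl)
    (by rintro (l | l | l)
        exacts [.inl ⟨.inl l, rfl⟩, .inr ⟨l, rfl⟩, .inl ⟨.inr l, rfl⟩])
    (by rintro (l | l) <;> simp [subst₁₃, taylorVars]) (fun l => by simp [subst₁₃]) p hF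

theorem expand₂₃_act₃ (p : MvPolynomial (Fin n ⊕ Fin n ⊕ Fin n) ℂ)
    {F : Exp n × Exp n × Exp n → U} (hF : F ∈ quasiAlong (place₂₃ n) U) :
    act₃ U p F ∈ quasiAlong (place₂₃ n) U ∧ expandAlong (place₂₃ n) (act₃ U p F) =
      act₃ U (subst₂₃ n p) (expandAlong (place₂₃ n) F) :=
  expandAlong_act₃ (v := Sum.inr) (u := Sum.inl)
    (by rintro (l | l) <;> rfl) (fun _ => rfl)
    (by rintro (l | l | l)
        exacts [.inr ⟨l, rfl⟩, .inl ⟨.inl l, rfl⟩, .inl ⟨.inr l, rfl⟩])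
    (by rintro (l | l) <;> simp [subst₂₃, taylorVars]) (fun l => by simp [subst₂₃]) p hF

theorem expand₁₂_apply (F : Exp n × Exp n × Exp n → U) (a b c : Exp n) :
    expandAlong (place₁₂ n) F (a, b, c) = expand (fun p => F (p.1, p.2, c)) (a, b) := rfl

theorem expand₁₃_apply (F : Exp n × Exp n × Exp n → U) (a b c : Exp n) :
    expandAlong (place₁₃ n) F (a, b, c) = expand (fun p => F (p.1, b, p.2)) (a, c) := rfl

theorem expand₂₃_apply (F : Exp n × Exp n × Exp n → U) (a b c : Exp n) :
    expandAlong (place₂₃ n) F (a, b, c) = expand (fun p => F (a, p.1, p.2)) (b, c) := rfl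

theorem expand_eq_sum {F : Exp n × Exp n → U} {l : Exp n × Exp n} (hl : ∀ g, F g ≠ 0 → l ≤ g)
    (j b : Exp n) {s : Finset (Exp n)} (hs : Finset.Icc l.1 (b + j - l.2) ⊆ s) :
    expand F (j, b) = ∑ r ∈ s, vecChoose r j • F (r, b + j - r) := by
  rw [expand_of_isLaurent ⟨l, fun g hg => hl g hg⟩, taylor_eq_sum hl j b hs]

variable {H : Exp n × Exp n × Exp n → U} {l₁ l₂ l₃ : Exp n}

theorem expand₂₃_ne_zero (hl : ∀ g, H g ≠ 0 → (l₁, l₂, l₃) ≤ g) {a j b : Exp n}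
    (h : expandAlong (place₂₃ n) H (a, j, b) ≠ 0) : 0 ≤ j ∧ l₁ ≤ a ∧ l₂ + l₃ - j ≤ b := by
  rw [expand₂₃_apply, expand_eq_sum (l := (l₂, l₃)) (fun g hg => (hl _ hg).2) _ _ subset_rfl] at h
  obtain ⟨r, -, hr⟩ := Finset.exists_ne_zero_of_sum_ne_zero h
  rw [smul_ne_zero_iff] at hr
  have h := hl _ hr.2
  refine ⟨not_imp_comm.1 vecChoose_eq_zero hr.1, h.1, ?_⟩
  have := add_le_add h.2.1 h.2.2
  rw [sub_le_iff_le_add]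
  simpa using this

theorem expand₁₃_ne_zero (hl : ∀ g, H g ≠ 0 → (l₁, l₂, l₃) ≤ g) {i s b : Exp n}
    (h : expandAlong (place₁₃ n) H (i, s, b) ≠ 0) : 0 ≤ i ∧ l₂ ≤ s ∧ l₁ + l₃ - i ≤ b := by
  rw [expand₁₃_apply, expand_eq_sum (l := (l₁, l₃))
    (fun g hg => ⟨(hl _ hg).1, (hl _ hg).2.2⟩) _ _ subset_rfl] at h
  obtain ⟨r, -, hr⟩ := Finset.exists_ne_zero_of_sum_ne_zero h
  rw [smul_ne_zero_iff] at hr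
  have h := hl _ hr.2
  refine ⟨not_imp_comm.1 vecChoose_eq_zero hr.1, h.2.1, ?_⟩
  have := add_le_add h.1 h.2.2
  rw [sub_le_iff_le_add]
  simpa using this

theorem expand₁₂_ne_zero (hl : ∀ g, H g ≠ 0 → (l₁, l₂, l₃) ≤ g) {i s c : Exp n}
    (h : expandAlong (place₁₂ n) H (i, s, c) ≠ 0) : l₁ + l₂ - i ≤ s ∧ l₃ ≤ c := by
  rw [expand₁₂_apply, expand_eq_sum (l := (l₁, l₂))
    (fun g hg => ⟨(hl _ hg).1, (hl _ hg).2.1⟩) _ _ subset_rfl] at h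
  obtain ⟨r, -, hr⟩ := Finset.exists_ne_zero_of_sum_ne_zero h
  rw [smul_ne_zero_iff] at hr
  have h := hl _ hr.2
  refine ⟨?_, h.2.2⟩
  have := add_le_add h.1 h.2.1
  rw [sub_le_iff_le_add]
  simpa using this

theorem expand₁₃_expand₂₃_eq_sum (hl : ∀ g, H g ≠ 0 → (l₁, l₂, l₃) ≤ g) (i j b : Exp n) :
    expandAlong (place₁₃ n) (expandAlong (place₂₃ n) H) (i, j, b) =
      ∑ r ∈ Finset.Icc l₁ (b + j + i - l₂ - l₃), ∑ s ∈ Finset.Icc l₂ (b + j + i - l₁ - l₃),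
        (vecChoose r i * vecChoose s j) • H (r, s, b + j + i - r - s) := by
  rw [expand₁₃_apply, expand_eq_sum (l := (l₁, l₂ + l₃ - j))
    (s := Finset.Icc l₁ (b + j + i - l₂ - l₃))
    (fun g hg => ⟨(expand₂₃_ne_zero hl hg).2.1, (expand₂₃_ne_zero hl hg).2.2⟩)]
  · refine Finset.sum_congr rfl fun r hr => ?_
    rw [expand₂₃_apply, expand_eq_sum (l := (l₂, l₃)) (fun g hg => (hl _ hg).2)
      (s := Finset.Icc l₂ (b + j + i - l₁ - l₃)), Finset.smul_sum]
    · refine Finset.sum_congr rfl fun s _ => ?_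
      rw [smul_smul, show b + i - r + j - s = b + j + i - r - s by abel]
    · refine Finset.Icc_subset_Icc_right ?_
      rw [show b + i - r + j - l₃ = b + j + i - r - l₃ by abel]
      exact sub_le_sub_right (sub_le_sub_left (Finset.mem_Icc.1 hr).1 _) _
  · rw [show b + i - (l₂ + l₃ - j) = b + j + i - l₂ - l₃ by abel]

theorem expand₂₃_expand₁₃_eq_sum (hl : ∀ g, H g ≠ 0 → (l₁, l₂, l₃) ≤ g) (i j b : Exp n) :
    expandAlong (place₂₃ n) (expandAlong (place₁₃ n) H) (i, j, b) =
      ∑ s ∈ Finset.Icc l₂ (b + j + i - l₁ - l₃), ∑ r ∈ Finset.Icc l₁ (b + j + i - l₂ - l₃),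
        (vecChoose r i * vecChoose s j) • H (r, s, b + j + i - r - s) := by
  rw [expand₂₃_apply, expand_eq_sum (l := (l₂, l₁ + l₃ - i))
    (s := Finset.Icc l₂ (b + j + i - l₁ - l₃))
    (fun g hg => ⟨(expand₁₃_ne_zero hl hg).2.1, (expand₁₃_ne_zero hl hg).2.2⟩)]
  · refine Finset.sum_congr rfl fun s hs => ?_
    rw [expand₁₃_apply, expand_eq_sum (l := (l₁, l₃))
      (fun g hg => ⟨(hl _ hg).1, (hl _ hg).2.2⟩)
      (s := Finset.Icc l₁ (b + j + i - l₂ - l₃)), Finset.smul_sum]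
    · refine Finset.sum_congr rfl fun r _ => ?_
      rw [smul_smul, mul_comm, show b + j - s + i - r = b + j + i - r - s by abel]
    · refine Finset.Icc_subset_Icc_right ?_
      rw [show b + j - s + i - l₃ = b + j + i - s - l₃ by abel]
      exact sub_le_sub_right (sub_le_sub_left (Finset.mem_Icc.1 hs).1 _) _
  · rw [show b + j - (l₁ + l₃ - i) = b + j + i - l₁ - l₃ by abel]

theorem expand₁₃_expand₂₃_comm (hH : IsLaurent H) :
    expandAlong (place₁₃ n) (expandAlong (place₂₃ n) H) =
      expandAlong (place₂₃ n) (expandAlong (place₁₃ n) H) := by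
  obtain ⟨⟨l₁, l₂, l₃⟩, hl⟩ := hH
  ext ⟨i, j, b⟩
  rw [expand₁₃_expand₂₃_eq_sum fun g hg => hl hg, expand₂₃_expand₁₃_eq_sum fun g hg => hl hg,
    Finset.sum_comm]

theorem expand₂₃_expand₁₂_eq_sum (hl : ∀ g, H g ≠ 0 → (l₁, l₂, l₃) ≤ g) (i j b : Exp n) :
    expandAlong (place₂₃ n) (expandAlong (place₁₂ n) H) (i, j, b) =
      ∑ r ∈ Finset.Icc l₁ (b + j + i - l₂ - l₃), ∑ s ∈ Finset.Icc l₂ (b + j + i - l₁ - l₃),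
        (vecChoose r i * vecChoose (s + r - i) j) • H (r, s, b + j + i - r - s) := by
  rw [expand₂₃_apply, expand_eq_sum (l := (l₁ + l₂ - i, l₃))
    (fun g hg => expand₁₂_ne_zero hl hg) _ _ subset_rfl]
  have h : ∀ s ∈ Finset.Icc (l₁ + l₂ - i) (b + j - l₃),
      vecChoose s j • expandAlong (place₁₂ n) H (i, s, b + j - s) =
      ∑ r ∈ Finset.Icc l₁ (b + j + i - l₂ - l₃),
        (vecChoose r i * vecChoose s j) • H (r, s + i - r, b + j - s) := fun s hs => by
    rw [expand₁₂_apply, expand_eq_sum (l := (l₁, l₂))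
      (fun g hg => ⟨(hl _ hg).1, (hl _ hg).2.1⟩)
      (s := Finset.Icc l₁ (b + j + i - l₂ - l₃)), Finset.smul_sum]
    · refine Finset.sum_congr rfl fun r _ => ?_
      rw [smul_smul, mul_comm]
    · refine Finset.Icc_subset_Icc_right ?_
      rw [show b + j + i - l₂ - l₃ = b + j - l₃ + i - l₂ by abel]
      exact sub_le_sub_right (add_le_add_left (Finset.mem_Icc.1 hs).2 _) _
  rw [Finset.sum_congr rfl h, Finset.sum_comm]
  refine Finset.sum_congr rfl fun r hr => ?_
  -- The two intervals of summation do not correspond under the shift s ↦ s + r - i; they only both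
  -- contain the support. Hence the detour through `finsum`.
  rw [← finsum_eq_sum_of_support_subset (fun s => (vecChoose r i * vecChoose s j) •
      H (r, s + i - r, b + j - s)),
    finsum_eq_sum_image (e := fun s => s + r - i) (s := Finset.Icc l₂ (b + j + i - l₁ - l₃))]
  · refine Finset.sum_congr rfl fun s _ => ?_
    rw [show s + r - i + i - r = s by abel, show b + j - (s + r - i) = b + j + i - r - s by abel]
  · intro s s' h
    exact add_left_injective r (sub_left_injective h)
  · intro s hs
    rw [smul_ne_zero_iff] at hs
    have h := hl _ hs.2
    refine ⟨s + i - r, Finset.mem_Icc.2 ⟨h.2.1, ?_⟩, by abel⟩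
    rw [show b + j + i - l₁ - l₃ = b + j - l₃ + i - l₁ by abel]
    exact sub_le_sub (add_le_add_left (le_sub_comm.1 h.2.2) _) h.1
  · intro s hs
    rw [Function.mem_support, smul_ne_zero_iff] at hs
    have h := hl _ hs.2
    refine Finset.mem_coe.2 (Finset.mem_Icc.2 ⟨?_, le_sub_comm.1 h.2.2⟩)
    rw [sub_le_iff_le_add]
    have := add_le_add h.1 h.2.1
    simpa using this

/-- Both sides are the substitution (x, y, z) ↦ (z + y + x, z + y, z), expanded in nonnegative
powers of x and y. Coefficientwise this is `vecChoose_comp`. -/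
theorem expand₁₂_expand₁₃_expand₂₃ (hH : IsLaurent H) :
    expandAlong (place₁₂ n) (expandAlong (place₁₃ n) (expandAlong (place₂₃ n) H)) =
      expandAlong (place₂₃ n) (expandAlong (place₁₂ n) H) := by
  obtain ⟨⟨l₁, l₂, l₃⟩, hl⟩ := hH
  have hl : ∀ g, H g ≠ 0 → (l₁, l₂, l₃) ≤ g := fun g hg => hl hg
  ext ⟨i, j, b⟩
  -- The bound `l := 0` is available because the first two substitutions leave only nonnegative
  -- exponents of x and y.
  rw [expand₂₃_expand₁₂_eq_sum hl, expand₁₂_apply, expand_eq_sum (l := 0) _ _ _ subset_rfl]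
  · have : ∀ q, b + (j + i - q) + q = b + j + i := fun q => by abel
    simp only [expand₁₃_expand₂₃_eq_sum hl, this, Finset.smul_sum]
    rw [Finset.sum_comm]
    refine Finset.sum_congr rfl fun r _ => ?_
    rw [Finset.sum_comm]
    refine Finset.sum_congr rfl fun s _ => ?_
    simp only [smul_smul, ← Finset.sum_smul]
    rw [Prod.fst_zero, Prod.snd_zero, sub_zero, vecChoose_comp]
  · rintro ⟨q, q'⟩ h
    dsimp only at h
    rw [expand₁₃_expand₂₃_eq_sum hl] at h
    obtain ⟨r, -, hr⟩ := Finset.exists_ne_zero_of_sum_ne_zero h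
    obtain ⟨s, -, hs⟩ := Finset.exists_ne_zero_of_sum_ne_zero hr
    rw [smul_ne_zero_iff, mul_ne_zero_iff] at hs
    exact ⟨not_imp_comm.1 vecChoose_eq_zero hs.1.1, not_imp_comm.1 vecChoose_eq_zero hs.1.2⟩

end ThreeVariables

/-! ### Cancelling the polynomial factors -/

section Polynomials

variable {n : ℕ} {U : Type*} [AddCommGroup U] [Module ℂ U]

/-- The polynomial `(x - y) ^ k` in the variables `x, y, z`. -/
noncomputable def diff₁₂ (n k : ℕ) : MvPolynomial (Fin n ⊕ Fin n ⊕ Fin n) ℂ :=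
  ∏ l, (var₁ l - var₂ l) ^ k

/-- The polynomial `(x - z) ^ k` in the variables `x, y, z`. -/
noncomputable def diff₁₃ (n k : ℕ) : MvPolynomial (Fin n ⊕ Fin n ⊕ Fin n) ℂ :=
  ∏ l, (var₁ l - var₃ l) ^ k

/-- The polynomial `(y - z) ^ k` in the variables `x, y, z`. -/
noncomputable def diff₂₃ (n k : ℕ) : MvPolynomial (Fin n ⊕ Fin n ⊕ Fin n) ℂ :=
  ∏ l, (var₂ l - var₃ l) ^ k

theorem act₃_diff₁₂_apply (k : ℕ) (F : Exp n × Exp n × Exp n → U) (a b c : Exp n) :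
    act₃ U (diff₁₂ n k) F (a, b, c) =
      act₂ U (diffPow fun _ => k) (fun p => F (p.1, p.2, c)) (a, b) := by
  have h : diff₁₂ n k = rename (Sum.map id Sum.inl) (diffPow fun _ : Fin n => k) := by
    simp [diff₁₂, diffPow]
  rw [h]
  exact polyEnd_rename_comp _ (fun p : Exp n × Exp n => (p.1, p.2, c))
    (by rintro g (l | l) <;> simp [pairExp, tripleExp]) _ F (a, b)

theorem act₃_diff₁₃_apply (k : ℕ) (F : Exp n × Exp n × Exp n → U) (a b c : Exp n) :
    act₃ U (diff₁₃ n k) F (a, b, c) =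
      act₂ U (diffPow fun _ => k) (fun p => F (p.1, b, p.2)) (a, c) := by
  have h : diff₁₃ n k = rename (Sum.map id Sum.inr) (diffPow fun _ : Fin n => k) := by
    simp [diff₁₃, diffPow]
  rw [h]
  exact polyEnd_rename_comp _ (fun p : Exp n × Exp n => (p.1, b, p.2))
    (by rintro g (l | l) <;> simp [pairExp, tripleExp]) _ F (a, c)

theorem act₃_diff₂₃_apply (k : ℕ) (F : Exp n × Exp n × Exp n → U) (a b c : Exp n) :
    act₃ U (diff₂₃ n k) F (a, b, c) =
      act₂ U (diffPow fun _ => k) (fun p => F (a, p.1, p.2)) (b, c) := by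
  have h : diff₂₃ n k = rename Sum.inr (diffPow fun _ : Fin n => k) := by
    simp [diff₂₃, diffPow]
  rw [h]
  exact polyEnd_rename_comp _ (fun p : Exp n × Exp n => (a, p.1, p.2))
    (by rintro ⟨g, g'⟩ (l | l) <;> simp [pairExp, tripleExp]) _ F (b, c)

/-- Monomials are invertible: they only shift exponents. -/
theorem act₃_prod_X_injective (v : Fin n → Fin n ⊕ Fin n ⊕ Fin n) (k : ℕ) :
    Function.Injective (act₃ U (∏ l, X (v l) ^ k)) := by
  intro F F' h
  ext g
  have := congrFun h (g + ∑ l, k • tripleExp n (v l))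
  rwa [polyEnd_prod_X_pow _ _ _ fun _ => k, polyEnd_prod_X_pow _ _ _ fun _ => k,
    add_sub_cancel_right] at this

/-- A series killed by x_l + y_l is, up to sign, constant along the direction raising y_l and
lowering x_l. Following it leaves the range of x-exponents. Without the bound, delta series would be
counterexamples. -/
theorem eq_zero_of_act₃_add {F : Exp n × Exp n × Exp n → U}
    (hF : F ∈ boundedSub (AddMonoidHom.fst (Exp n) (Exp n × Exp n)) U) (l : Fin n)
    (h : act₃ U (var₁ l + var₂ l) F = 0) : F = 0 := by
  obtain ⟨m, hm⟩ := hF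
  have hstep : ∀ a b c, F (a, b, c) = -F (a - Pi.single l 1, b + Pi.single l 1, c) := by
    intro a b c
    have := congrFun h (a, b + Pi.single l 1, c)
    rw [map_add, LinearMap.add_apply, Pi.add_apply, polyEnd_X, polyEnd_X] at this
    simp only [tripleExp, Sum.elim_inl, Sum.elim_inr, Prod.mk_sub_mk, sub_zero,
      add_sub_cancel_right, Pi.zero_apply] at this
    rw [add_comm] at this
    exact eq_neg_of_add_eq_zero_left this
  have key : ∀ (t : ℕ) (a b c : Exp n), a l < m l + t → F (a, b, c) = 0 := by
    intro t
    induction t with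
    | zero =>
      intro a b c ha
      by_contra hne
      have := hm _ hne l
      simp only [AddMonoidHom.coe_fst] at this
      lia
    | succ t ih =>
      intro a b c ha
      rw [hstep, ih, neg_zero]
      rw [Pi.sub_apply, Pi.single_eq_same]
      push_cast at ha
      lia
  ext ⟨a, b, c⟩
  exact key (a l - m l + 1).toNat a b c (by lia)

theorem eq_zero_of_act₃_prod_add {F : Exp n × Exp n × Exp n → U}
    (hF : F ∈ boundedSub (AddMonoidHom.fst (Exp n) (Exp n × Exp n)) U) (k : ℕ)
    (h : act₃ U (∏ l, (var₁ l + var₂ l) ^ k) F = 0) : F = 0 := by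
  have hpow : ∀ (l : Fin n) (k : ℕ) (F : Exp n × Exp n × Exp n → U),
      F ∈ boundedSub (AddMonoidHom.fst (Exp n) (Exp n × Exp n)) U →
      act₃ U ((var₁ l + var₂ l) ^ k) F = 0 → F = 0 := by
    intro l k
    induction k with
    | zero => intro F _ h; simpa using h
    | succ k ih =>
      intro F hF h
      rw [pow_succ, polyEnd_mul_apply] at h
      exact eq_zero_of_act₃_add hF l (ih _ (polyEnd_mem_boundedSub _ _ _ hF) h)
  have hprod : ∀ (s : Finset (Fin n)) (F : Exp n × Exp n × Exp n → U),
      F ∈ boundedSub (AddMonoidHom.fst (Exp n) (Exp n × Exp n)) U →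
      act₃ U (∏ l ∈ s, (var₁ l + var₂ l) ^ k) F = 0 → F = 0 := by
    intro s
    induction s using Finset.induction_on with
    | empty => intro F _ h; simpa using h
    | insert l s hl ih =>
      intro F hF h
      rw [Finset.prod_insert hl, polyEnd_mul_apply] at h
      exact ih F hF (hpow l k _ (polyEnd_mem_boundedSub _ _ _ hF) h)
  exact hprod _ F hF h

/-- In each coordinate, s^(N+L) = ((t + s) - t)^(N+L), and every term of the binomial expansion is
divisible by (t + s)^N or by t^L. The product of the cofactors works modulo the ideal. -/
theorem exists_prod_pow_sub_mem {R ι : Type*} [CommRing R] [Fintype ι] (s t : ι → R) (N L : ℕ) :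
    ∃ q, ∏ l, s l ^ (N + L) - (∏ l, (t l + s l) ^ N) * q ∈
      Ideal.span (Set.range fun l => t l ^ L) := by
  have h : ∀ l, ∃ q r, s l ^ (N + L) = (t l + s l) ^ N * q + t l ^ L * r := fun l => by
    have := Ideal.add_pow_mem_of_pow_mem_of_le (Ideal.span {(t l + s l) ^ N, t l ^ L})
      (a := t l + s l) (b := -t l) (m := N) (n := L) (k := N + L)
      (Ideal.subset_span (by simp))
      (by rw [neg_pow]; exact Ideal.mul_mem_left _ _ (Ideal.subset_span (by simp))) (by lia)
    rw [add_neg_cancel_comm, Ideal.mem_span_pair] at this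
    obtain ⟨q, r, h⟩ := this
    exact ⟨q, r, by rw [← h]; ring⟩
  choose q r h using h
  refine ⟨∏ l, q l, ?_⟩
  rw [← Ideal.Quotient.mk_eq_mk_iff_sub_mem, ← Finset.prod_mul_distrib, map_prod, map_prod]
  refine Finset.prod_congr rfl fun l _ => ?_
  rw [Ideal.Quotient.mk_eq_mk_iff_sub_mem, h, add_sub_cancel_left]
  exact Ideal.mul_mem_right _ _ (Ideal.subset_span ⟨l, rfl⟩)

/-- The algebraic core of Dong's lemma. Modulo high powers of the x_l, a high power of y - z is a
multiple of (x + y - z)^N; those powers of x_l cannot affect the coefficient of x^i when the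
x-exponents of P are at least m. The exponent M does not depend on P. -/
theorem exists_act₃_diff₂₃_eq_zero (N : ℕ) (m i : Exp n) : ∃ M : ℕ,
    ∀ P : Exp n × Exp n × Exp n → U, (∀ g, P g ≠ 0 → m ≤ g.1) →
      act₃ U ((∏ l, (var₁ l + (var₂ l - var₃ l)) ^ N) * diff₂₃ n N) P = 0 →
      ∀ b c, act₃ U (diff₂₃ n M) P (i, b, c) = 0 := by
  -- Multiplication by x_l^L raises every exponent of x_l, which is at least m_l, above i_l.
  set L : ℕ := ∑ l, (i l - m l + 1).toNat
  obtain ⟨q, hq⟩ := exists_prod_pow_sub_mem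
    (fun l : Fin n => (var₂ l - var₃ l : MvPolynomial (Fin n ⊕ Fin n ⊕ Fin n) ℂ)) var₁ N L
  refine ⟨N + L + N, fun P hP h b c => ?_⟩
  -- These series have no term with x-exponent at most i; polynomials preserve this since they never
  -- lower exponents.
  let S : Submodule ℂ (Exp n × Exp n × Exp n → U) :=
    { carrier := {F | ∀ g, g.1 ≤ i → F g = 0}
      zero_mem' := fun _ _ => rfl
      add_mem' := fun h h' g hg => by rw [Pi.add_apply, h g hg, h' g hg, add_zero]
      smul_mem' := fun c F h g hg => by rw [Pi.smul_apply, h g hg, smul_zero] }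
  have hS : ∀ s, ∀ F ∈ S, act₃ U (X s) F ∈ S := by
    intro s F hF g hg
    rw [polyEnd_X]
    refine hF _ (le_trans ?_ hg)
    rw [Prod.fst_sub, sub_le_self_iff]
    rcases s with l | l | l
    · exact Pi.single_nonneg.2 zero_le_one
    · exact le_rfl
    · exact le_rfl
  have hmem : ∀ x ∈ Ideal.span (Set.range fun l : Fin n => var₁ l ^ L), act₃ U x P ∈ S := by
    intro x hx
    induction hx using Submodule.span_induction with
    | mem x hx =>
      obtain ⟨l, rfl⟩ := hx
      intro g hg
      dsimp only
      rw [polyEnd_X_pow]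
      by_contra hne
      have h1 := hP _ hne l
      have h2 := Finset.single_le_sum (f := fun l => (i l - m l + 1).toNat)
        (fun _ _ => Nat.zero_le _) (Finset.mem_univ l)
      have h3 : (g - L • tripleExp n (Sum.inl l)).1 l = g.1 l - L := by
        simp [tripleExp]
      have h4 := hg l
      change (i l - m l + 1).toNat ≤ L at h2
      lia
    | zero => rw [map_zero]; exact S.zero_mem
    | add x y _ _ hx hy => rw [map_add]; exact S.add_mem hx hy
    | smul a x _ hx => rw [smul_eq_mul, polyEnd_mul_apply]; exact polyEnd_mem _ S hS a _ hx
  have hpoly : diff₂₃ n (N + L + N) = diff₂₃ n N *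
      (∏ l, (var₂ l - var₃ l) ^ (N + L) - (∏ l, (var₁ l + (var₂ l - var₃ l)) ^ N) * q) +
      q * ((∏ l, (var₁ l + (var₂ l - var₃ l)) ^ N) * diff₂₃ n N) := by
    have : diff₂₃ n (N + L + N) = diff₂₃ n N * ∏ l, (var₂ l - var₃ l) ^ (N + L) := by
      simp only [diff₂₃, ← Finset.prod_mul_distrib, ← pow_add]
      rw [add_comm (N + L)]
    rw [this]; ring
  rw [hpoly, map_add, LinearMap.add_apply, polyEnd_mul_apply _ q, h, map_zero, add_zero,
    polyEnd_mul_apply]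
  exact polyEnd_mem _ S hS _ _ (hmem _ hq) _ le_rfl

theorem subst₁₃_subst₂₃_diff (k k' : ℕ) :
    subst₁₃ n (subst₂₃ n (diff₁₂ n k * diff₁₃ n k' * diff₂₃ n k')) =
      (∏ l, var₁ l ^ k') * (∏ l, var₂ l ^ k') * diff₁₂ n k := by
  simp only [diff₁₂, diff₁₃, diff₂₃, subst₁₃, subst₂₃, map_mul, map_prod, map_pow, map_sub,
    map_add, aeval_X, Sum.elim_inl, Sum.elim_inr, ← Finset.prod_mul_distrib]
  exact Finset.prod_congr rfl fun l _ => by ring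

theorem subst₂₃_subst₁₃_diff (k k' : ℕ) :
    subst₂₃ n (subst₁₃ n (diff₁₂ n k * diff₁₃ n k' * diff₂₃ n k')) =
      (∏ l, var₁ l ^ k') * (∏ l, var₂ l ^ k') * diff₁₂ n k := by
  simp only [diff₁₂, diff₁₃, diff₂₃, subst₁₃, subst₂₃, map_mul, map_prod, map_pow, map_sub,
    map_add, aeval_X, Sum.elim_inl, Sum.elim_inr, ← Finset.prod_mul_distrib]
  exact Finset.prod_congr rfl fun l _ => by ring

theorem subst₁₂_diff (k k' : ℕ) :
    subst₁₂ n ((∏ l, var₁ l ^ k') * (∏ l, var₂ l ^ k') * diff₁₂ n k) =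
      (∏ l, var₁ l ^ k) * (∏ l, var₂ l ^ k') * ∏ l, (var₁ l + var₂ l) ^ k' := by
  simp only [diff₁₂, subst₁₂, map_mul, map_prod, map_pow, map_sub,
    aeval_X, Sum.elim_inl, Sum.elim_inr, ← Finset.prod_mul_distrib]
  exact Finset.prod_congr rfl fun l _ => by ring

theorem subst₂₃_subst₁₂_diff (k k' : ℕ) :
    subst₂₃ n (subst₁₂ n (diff₁₂ n k * diff₁₃ n k' * diff₂₃ n k')) =
      (∏ l, var₁ l ^ k) * (∏ l, var₂ l ^ k') * ∏ l, (var₁ l + var₂ l) ^ k' := by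
  simp only [diff₁₂, diff₁₃, diff₂₃, subst₁₂, subst₂₃, map_mul, map_prod, map_pow, map_sub,
    map_add, aeval_X, Sum.elim_inl, Sum.elim_inr, ← Finset.prod_mul_distrib]
  exact Finset.prod_congr rfl fun l _ => by ring

theorem subst₁₂_diff₁₃_diff₂₃ (k : ℕ) : subst₁₂ n (diff₁₃ n k * diff₂₃ n k) =
    (∏ l, (var₁ l + (var₂ l - var₃ l)) ^ k) * diff₂₃ n k := by
  simp only [diff₁₃, diff₂₃, subst₁₂, map_mul, map_prod, map_pow, map_sub,
    aeval_X, Sum.elim_inl, Sum.elim_inr, ← Finset.prod_mul_distrib]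
  exact Finset.prod_congr rfl fun l _ => by ring

/-- The expansions of a product of three vertex operators and of the product with the first two
factors exchanged agree up to a power of `x - y`. -/
theorem act₃_expand₁₃_expand₂₃_comm {T T' : Exp n × Exp n × Exp n → U} {N N' : ℕ}
    (h : act₃ U (diff₁₂ n N) T = act₃ U (diff₁₂ n N) T')
    (hH : IsLaurent (act₃ U (diff₁₂ n N * diff₁₃ n N' * diff₂₃ n N') T))
    (h₁ : T ∈ quasiAlong (place₂₃ n) U)
    (h₂ : expandAlong (place₂₃ n) T ∈ quasiAlong (place₁₃ n) U)
    (h₁' : T' ∈ quasiAlong (place₁₃ n) U)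
    (h₂' : expandAlong (place₁₃ n) T' ∈ quasiAlong (place₂₃ n) U) :
    act₃ U (diff₁₂ n N) (expandAlong (place₁₃ n) (expandAlong (place₂₃ n) T)) =
      act₃ U (diff₁₂ n N) (expandAlong (place₂₃ n) (expandAlong (place₁₃ n) T')) := by
  have hT : act₃ U (diff₁₂ n N * diff₁₃ n N' * diff₂₃ n N') T =
      act₃ U (diff₁₂ n N * diff₁₃ n N' * diff₂₃ n N') T' := by
    rw [mul_assoc, mul_comm, polyEnd_mul_apply, h, ← polyEnd_mul_apply]
  have := expand₁₃_expand₂₃_comm hH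
  nth_rw 2 [hT] at this
  -- The substitutions fix x - y and turn x - z and y - z into the monomial factors x and y, which
  -- can be cancelled.
  rw [(expand₂₃_act₃ _ h₁).2, (expand₁₃_act₃ _ h₂).2, (expand₁₃_act₃ _ h₁').2,
    (expand₂₃_act₃ _ h₂').2, subst₁₃_subst₂₃_diff, subst₂₃_subst₁₃_diff, mul_assoc,
    polyEnd_mul_apply, polyEnd_mul_apply, polyEnd_mul_apply, polyEnd_mul_apply] at this
  exact act₃_prod_X_injective _ _ (act₃_prod_X_injective _ _ this)

/-- Associativity of the expansions of a product of three vertex operators. -/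
theorem expand₁₂_expand₁₃_expand₂₃_eq {T : Exp n × Exp n × Exp n → U} {N N' : ℕ}
    (hH : IsLaurent (act₃ U (diff₁₂ n N * diff₁₃ n N' * diff₂₃ n N') T))
    (h₁ : T ∈ quasiAlong (place₂₃ n) U)
    (h₂ : expandAlong (place₂₃ n) T ∈ quasiAlong (place₁₃ n) U)
    (h₃ : expandAlong (place₁₃ n) (expandAlong (place₂₃ n) T) ∈ quasiAlong (place₁₂ n) U)
    (h₁' : T ∈ quasiAlong (place₁₂ n) U)
    (h₂' : expandAlong (place₁₂ n) T ∈ quasiAlong (place₂₃ n) U)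
    (hb : expandAlong (place₁₂ n) (expandAlong (place₁₃ n) (expandAlong (place₂₃ n) T)) ∈
      boundedSub (AddMonoidHom.fst (Exp n) (Exp n × Exp n)) U)
    (hb' : expandAlong (place₂₃ n) (expandAlong (place₁₂ n) T) ∈
      boundedSub (AddMonoidHom.fst (Exp n) (Exp n × Exp n)) U) :
    expandAlong (place₁₂ n) (expandAlong (place₁₃ n) (expandAlong (place₂₃ n) T)) =
      expandAlong (place₂₃ n) (expandAlong (place₁₂ n) T) := by
  have := expand₁₂_expand₁₃_expand₂₃ hH
  rw [(expand₂₃_act₃ _ h₁).2, (expand₁₃_act₃ _ h₂).2, subst₁₃_subst₂₃_diff,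
    (expand₁₂_act₃ _ h₃).2, subst₁₂_diff, (expand₁₂_act₃ _ h₁').2, (expand₂₃_act₃ _ h₂').2,
    subst₂₃_subst₁₂_diff, mul_assoc,
    polyEnd_mul_apply, polyEnd_mul_apply, polyEnd_mul_apply, polyEnd_mul_apply] at this
  -- Monomials in x and y cancel at once; the image x + y of x - z remains, and its powers are
  -- cancelled using the bounds on the exponents of x.
  have := act₃_prod_X_injective _ _ (act₃_prod_X_injective _ _ this)
  rw [← sub_eq_zero, ← map_sub] at this
  exact sub_eq_zero.1 (eq_zero_of_act₃_prod_add (Submodule.sub_mem _ hb hb') _ this)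

end Polynomials

/-! ### Locality, products of three operators and Dong's lemma -/

section Locality

variable {n : ℕ} {W : Type*} [AddCommGroup W] [Module ℂ W]

/-- Locality of two series with exponent `k`. -/
def LocalOfOrder (k : ℕ) (ψ φ : OpSeries (Exp n) W) : Prop :=
  ∀ w, act₂ W (diffPow fun _ => k) (pairSeries ψ φ w) =
    act₂ W (diffPow fun _ => k) fun g => φ g.2 (ψ g.1 w)

theorem LocalOfOrder.mono {k k' : ℕ} {ψ φ : OpSeries (Exp n) W} (h : LocalOfOrder k ψ φ)
    (hk : k ≤ k') : LocalOfOrder k' ψ φ := fun w => by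
  rw [show (fun _ : Fin n => k') = (fun _ => k' - k) + fun _ => k by ext; simp [hk],
    diffPow_add, polyEnd_mul_apply, polyEnd_mul_apply, h w]

/-- Exchanging x and y changes (x - y)^k only by the sign (-1)^(nk). -/
theorem LocalOfOrder.symm {k : ℕ} {ψ φ : OpSeries (Exp n) W} (h : LocalOfOrder k ψ φ) :
    LocalOfOrder k φ ψ := fun w => by
  have key : ∀ F : Exp n × Exp n → W, (fun g => act₂ W (diffPow fun _ => k) F (g.2, g.1)) =
      act₂ W (C ((-1) ^ (n * k)) * diffPow fun _ => k) fun g => F (g.2, g.1) := fun F => by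
    have hp : rename Sum.swap (C ((-1 : ℂ) ^ (n * k)) * diffPow fun _ : Fin n => k) =
        diffPow fun _ => k := by
      have : ∀ l : Fin n, (X (Sum.inr l) - X (Sum.inl l) : MvPolynomial (Fin n ⊕ Fin n) ℂ) ^ k =
          (-1) ^ k * (X (Sum.inl l) - X (Sum.inr l)) ^ k := fun l => by
        rw [← mul_pow]; ring
      simp only [diffPow, map_mul, map_prod, map_pow, map_sub, rename_X, Sum.swap_inl,
        Sum.swap_inr, this, Finset.prod_mul_distrib, Finset.prod_const, Finset.card_univ,
        Fintype.card_fin, map_neg, map_one]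
      rw [← mul_assoc, ← pow_mul, mul_comm k n, ← mul_pow]
      simp
    ext g
    have := polyEnd_rename_comp (e := pairExp n) (e' := pairExp n) Sum.swap Prod.swap
      (by rintro ⟨g, g'⟩ (l | l) <;> simp [pairExp])
      (C ((-1 : ℂ) ^ (n * k)) * diffPow fun _ : Fin n => k) F g
    rw [hp] at this
    exact this
  have h1 := congrArg (fun F => fun g : Exp n × Exp n => F (g.2, g.1)) (h w)
  simp only [key] at h1
  rw [polyEnd_mul_apply, polyEnd_mul_apply, polyEnd_C, polyEnd_C] at h1
  exact (smul_right_injective _ (pow_ne_zero _ (by norm_num)) h1).symm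

theorem mutuallyLocal_iff_exists {ψ φ : OpSeries (Exp n) W} :
    MutuallyLocal ψ φ ↔ ∃ k, LocalOfOrder k ψ φ := mutuallyLocal_iff

theorem MutuallyLocal.symm {ψ φ : OpSeries (Exp n) W} (h : MutuallyLocal ψ φ) :
    MutuallyLocal φ ψ := by
  rw [mutuallyLocal_iff_exists] at h ⊢
  exact h.imp fun k hk => hk.symm

theorem MutuallyLocal.add_left {ψ ψ' φ : OpSeries (Exp n) W} (h : MutuallyLocal ψ φ)
    (h' : MutuallyLocal ψ' φ) : MutuallyLocal (ψ + ψ') φ := by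
  rw [mutuallyLocal_iff_exists] at h h' ⊢
  obtain ⟨k, hk⟩ := h
  obtain ⟨k', hk'⟩ := h'
  refine ⟨max k k', fun w => ?_⟩
  have h1 := hk.mono (le_max_left k k') w
  have h2 := hk'.mono (le_max_right k k') w
  have e1 : pairSeries (ψ + ψ') φ w = pairSeries ψ φ w + pairSeries ψ' φ w := rfl
  have e2 : (fun g : Exp n × Exp n => φ g.2 ((ψ + ψ') g.1 w)) =
      (fun g => φ g.2 (ψ g.1 w)) + fun g => φ g.2 (ψ' g.1 w) := by
    ext g; simp
  rw [e1, e2, map_add, map_add, h1, h2]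

theorem MutuallyLocal.smul_left {ψ φ : OpSeries (Exp n) W} (c : ℂ) (h : MutuallyLocal ψ φ) :
    MutuallyLocal (c • ψ) φ := by
  rw [mutuallyLocal_iff] at h ⊢
  refine h.imp fun k hk w => ?_
  have e1 : pairSeries (c • ψ) φ w = c • pairSeries ψ φ w := rfl
  have e2 : (fun g : Exp n × Exp n => φ g.2 ((c • ψ) g.1 w)) =
      c • fun g => φ g.2 (ψ g.1 w) := by
    ext g; simp
  rw [e1, e2, map_smul, map_smul, hk]

theorem mutuallyLocal_idSeries_left (φ : OpSeries (Exp n) W) :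
    MutuallyLocal (idSeries n W) φ := by
  refine mutuallyLocal_iff.2 ⟨0, fun w => ?_⟩
  congr 1
  ext ⟨a, b⟩
  by_cases ha : a = 0
  · subst ha; simp [pairSeries, idSeries]
  · simp [pairSeries, idSeries, Pi.single_eq_of_ne ha]

theorem idSeries_mem_VO (n : ℕ) (W : Type*) [AddCommGroup W] [Module ℂ W] :
    idSeries n W ∈ VO n W := fun w => by
  refine ⟨0, fun a ha => ?_⟩
  by_contra h
  have h0 : a ≠ 0 := by rintro rfl; exact h le_rfl
  exact ha (by simp [idSeries, Pi.single_eq_of_ne h0])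

theorem nthProd_mem_VO {ψ φ : OpSeries (Exp n) W} (hψ : ψ ∈ VO n W) (hφ : φ ∈ VO n W)
    (h : MutuallyLocal ψ φ) (m : Exp n) : nthProd ψ m φ ∈ VO n W := by
  obtain ⟨K, hK⟩ := h.isLaurent hψ hφ
  intro w
  simp only [nthProd_apply hφ hK]
  exact isLaurent_expand ⟨K, hK w⟩ _

variable {u v w : OpSeries (Exp n) W} {N N' : ℕ}

/-- The series `u(x) v(y) w(z) ω`. -/
def tripleSeries (u v w : OpSeries (Exp n) W) (ω : W) : Exp n × Exp n × Exp n → W :=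
  fun g => u g.1 (v g.2.1 (w g.2.2 ω))

theorem act₃_diff₁₂_tripleSeries (h : LocalOfOrder N u v) (w : OpSeries (Exp n) W) (ω : W) :
    act₃ W (diff₁₂ n N) (tripleSeries u v w ω) =
      act₃ W (diff₁₂ n N) fun g => v g.2.1 (u g.1 (w g.2.2 ω)) := by
  ext ⟨a, b, c⟩
  rw [act₃_diff₁₂_apply, act₃_diff₁₂_apply]
  exact congrFun (h (w c ω)) (a, b)

theorem act₃_diff₂₃_tripleSeries (h : LocalOfOrder N v w) (u : OpSeries (Exp n) W) (ω : W) :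
    act₃ W (diff₂₃ n N) (tripleSeries u v w ω) =
      act₃ W (diff₂₃ n N) fun g => u g.1 (w g.2.2 (v g.2.1 ω)) := by
  ext ⟨a, b, c⟩
  rw [act₃_diff₂₃_apply, act₃_diff₂₃_apply]
  have := congrArg (fun F => u a (F (b, c))) (h ω)
  simp only [polyEnd_map] at this
  exact this

theorem act₃_diff₁₃_tripleSeries (h : LocalOfOrder N u w) (v : OpSeries (Exp n) W) (ω : W) :
    (act₃ W (diff₁₃ n N) fun g => u g.1 (w g.2.2 (v g.2.1 ω))) =
      act₃ W (diff₁₃ n N) fun g => w g.2.2 (u g.1 (v g.2.1 ω)) := by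
  ext ⟨a, b, c⟩
  rw [act₃_diff₁₃_apply, act₃_diff₁₃_apply]
  exact congrFun (h (v b ω)) (a, c)

theorem act₃_diff₁₃_diff₂₃_tripleSeries (huw : LocalOfOrder N' u w) (hvw : LocalOfOrder N' v w)
    (ω : W) : act₃ W (diff₁₃ n N' * diff₂₃ n N') (tripleSeries u v w ω) =
      act₃ W (diff₁₃ n N' * diff₂₃ n N') fun g => w g.2.2 (u g.1 (v g.2.1 ω)) := by
  rw [polyEnd_mul_apply, act₃_diff₂₃_tripleSeries hvw, ← polyEnd_mul_apply, mul_comm,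
    polyEnd_mul_apply, act₃_diff₁₃_tripleSeries huw, ← polyEnd_mul_apply]

theorem act₃_diff_tripleSeries (huv : LocalOfOrder N u v) (huw : LocalOfOrder N' u w)
    (hvw : LocalOfOrder N' v w) (ω : W) :
    act₃ W (diff₁₂ n N * diff₁₃ n N' * diff₂₃ n N') (tripleSeries u v w ω) =
      act₃ W (diff₁₂ n N * diff₁₃ n N' * diff₂₃ n N') fun g => w g.2.2 (v g.2.1 (u g.1 ω)) := by
  have h : (act₃ W (diff₁₂ n N) fun g => w g.2.2 (u g.1 (v g.2.1 ω))) =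
      act₃ W (diff₁₂ n N) fun g => w g.2.2 (v g.2.1 (u g.1 ω)) := by
    ext ⟨a, b, c⟩
    rw [act₃_diff₁₂_apply, act₃_diff₁₂_apply]
    have := congrArg (fun F => w c (F (a, b))) (huv ω)
    simp only [polyEnd_map] at this
    exact this
  rw [mul_assoc, polyEnd_mul_apply, act₃_diff₁₃_diff₂₃_tripleSeries huw hvw,
    ← polyEnd_mul_apply, mul_comm, polyEnd_mul_apply, h, ← polyEnd_mul_apply]

/-- The operator acting first on ω has its exponents bounded below. The locality factors permit
reordering so that each of the three operators acts first in turn. -/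
theorem isLaurent_diff_tripleSeries (hu : u ∈ VO n W) (hv : v ∈ VO n W) (hw : w ∈ VO n W)
    (huv : LocalOfOrder N u v) (huw : LocalOfOrder N' u w) (hvw : LocalOfOrder N' v w) (ω : W) :
    IsLaurent (act₃ W (diff₁₂ n N * diff₁₃ n N' * diff₂₃ n N') (tripleSeries u v w ω)) := by
  refine isLaurent_prod ?_ ?_
  · rw [act₃_diff_tripleSeries huv huw hvw]
    refine polyEnd_mem_boundedSub _ _ _ ?_
    obtain ⟨l, hl⟩ := hu ω
    exact ⟨l, fun g hg => hl fun h => hg (by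
      have h : u g.1 ω = 0 := h
      simp only [h, map_zero])⟩
  have h₂ : act₃ W (diff₁₂ n N * diff₁₃ n N' * diff₂₃ n N') (tripleSeries u v w ω) ∈
      boundedSub ((AddMonoidHom.fst (Exp n) (Exp n)).comp (AddMonoidHom.snd (Exp n) _)) W := by
    rw [polyEnd_mul_apply, act₃_diff₂₃_tripleSeries hvw]
    refine polyEnd_mem_boundedSub _ _ _ (polyEnd_mem_boundedSub _ _ _ ?_)
    obtain ⟨l, hl⟩ := hv ω
    exact ⟨l, fun g hg => hl fun h => hg (by
      have h : v g.2.1 ω = 0 := h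
      simp only [h, map_zero])⟩
  have h₃ : act₃ W (diff₁₂ n N * diff₁₃ n N' * diff₂₃ n N') (tripleSeries u v w ω) ∈
      boundedSub ((AddMonoidHom.snd (Exp n) (Exp n)).comp (AddMonoidHom.snd (Exp n) _)) W := by
    refine polyEnd_mem_boundedSub _ _ _ ?_
    obtain ⟨l, hl⟩ := hw ω
    exact ⟨l, fun g hg => hl fun h => hg (by
      have h : w g.2.2 ω = 0 := h
      simp only [tripleSeries, h, map_zero])⟩
  obtain ⟨l, hl⟩ := h₂
  obtain ⟨l', hl'⟩ := h₃
  exact ⟨(l, l'), fun g hg => ⟨hl g hg, hl' g hg⟩⟩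

theorem pairSeries_mem_quasiLaurent (hu : u ∈ VO n W) (hv : v ∈ VO n W)
    (h : MutuallyLocal u v) (ω : W) : pairSeries u v ω ∈ quasiLaurent n W := by
  obtain ⟨K, hK⟩ := h.isLaurent hu hv
  exact ⟨K, hK ω⟩

theorem expand_pairSeries (hu : u ∈ VO n W) (hv : v ∈ VO n W) (h : MutuallyLocal u v)
    (i b : Exp n) (ω : W) : expand (pairSeries u v ω) (i, b) = nthProd u (-i - 1) v b ω := by
  obtain ⟨K, hK⟩ := h.isLaurent hu hv
  rw [nthProd_apply hv hK]
  congr 2; abel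

/-- Dong's lemma. -/
theorem MutuallyLocal.nthProd_left (hu : u ∈ VO n W) (hv : v ∈ VO n W)
    (huv : MutuallyLocal u v) (huw : MutuallyLocal u w) (hvw : MutuallyLocal v w) (m : Exp n) :
    MutuallyLocal (nthProd u m v) w := by
  obtain ⟨K, hK⟩ := huv.isLaurent hu hv
  rw [mutuallyLocal_iff_exists] at huw hvw
  obtain ⟨k, hk⟩ := huw
  obtain ⟨k', hk'⟩ := hvw
  have huw := hk.mono (le_max_left k k')
  have hvw := hk'.mono (le_max_right k k')
  generalize max k k' = N at huw hvw
  -- The pole of u(x)v(y) bounds the x-exponents below by -K, and the mode m is the coefficient of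
  -- x^(-m-1). As `M` is fixed before ω, it serves all vectors.
  obtain ⟨M, hM⟩ := exists_act₃_diff₂₃_eq_zero (n := n) (U := W) N (fun _ => -(K : ℤ)) (-m - 1)
  refine mutuallyLocal_iff.2 ⟨M, fun ω => ?_⟩
  have hT : tripleSeries u v w ω ∈ quasiAlong (place₁₂ n) W := fun c => ⟨K, hK (w c ω)⟩
  have hT' : (fun g => w g.2.2 (u g.1 (v g.2.1 ω))) ∈ quasiAlong (place₁₂ n) W := fun c =>
    quasiLaurent_map (F := pairSeries u v ω) ⟨K, hK ω⟩ (w c)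
  -- Substituting x ↦ y + x in the relation that moves w to the left turns its factor into (x + y -
  -- z)^N (y - z)^N, which kills the difference of the two expansions.
  have h1 := congrArg (expandAlong (place₁₂ n)) (act₃_diff₁₃_diff₂₃_tripleSeries huw hvw ω)
  rw [(expand₁₂_act₃ _ hT).2, (expand₁₂_act₃ _ hT').2, subst₁₂_diff₁₃_diff₂₃, ← sub_eq_zero,
    ← map_sub] at h1
  have e1 : ∀ i b c, expandAlong (place₁₂ n) (tripleSeries u v w ω) (i, b, c) =
      expand (pairSeries u v (w c ω)) (i, b) := fun i b c => rfl
  have e2 : ∀ i b c, expandAlong (place₁₂ n) (fun g => w g.2.2 (u g.1 (v g.2.1 ω))) (i, b, c) =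
      w c (expand (pairSeries u v ω) (i, b)) := fun i b c => expand_map (w c) ⟨K, hK ω⟩ _
  have h2 := hM _ (fun g hg => ?_) h1
  · ext ⟨b, c⟩
    have h2 := h2 b c
    rw [map_sub, Pi.sub_apply, sub_eq_zero, act₃_diff₂₃_apply, act₃_diff₂₃_apply] at h2
    simp only [e1, e2, ← nthProd_apply hv hK] at h2
    exact h2
  · obtain ⟨i, b, c⟩ := g
    rw [Pi.sub_apply, e1, e2] at hg
    by_contra hi
    have h3 : ∀ ω, expand (pairSeries u v ω) (i, b) = 0 := fun ω =>
      not_imp_comm.1 (le_of_expand_ne_zero (hK ω)) hi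
    rw [h3, h3, map_zero, sub_zero] at hg
    exact hg rfl

end Locality

/-! ### The vertex algebra structure on a closed local subspace -/

section NaturalStructure

variable {n : ℕ} {W : Type*} [AddCommGroup W] [Module ℂ W]
  {V : Submodule ℂ (OpSeries (Exp n) W)}

theorem IsLocalSubspace.quasi (hV : IsLocalSubspace V) (u v : V) (ω : W) :
    pairSeries (u : OpSeries (Exp n) W) v ω ∈ quasiLaurent n W :=
  pairSeries_mem_quasiLaurent (hV.1 u.2) (hV.1 v.2) (hV.2 _ u.2 _ v.2) ω

theorem IsLocalSubspace.expand_eq (hV : IsLocalSubspace V) (u v : V) (i b : Exp n) (ω : W) :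
    nthProd (u : OpSeries (Exp n) W) (-i - 1) v b ω =
      expand (pairSeries (u : OpSeries (Exp n) W) v ω) (i, b) :=
  (expand_pairSeries (hV.1 u.2) (hV.1 v.2) (hV.2 _ u.2 _ v.2) i b ω).symm

/-- The vertex operator map of a closed local subspace. -/
noncomputable def naturalY (hV : IsClosedLocalSubspace V) : V →ₗ[ℂ] OpSeries (Exp n) V where
  toFun u a :=
    { toFun := fun v => ⟨nthProd (u : OpSeries (Exp n) W) (-a - 1) v,
        hV.2 _ u.2 _ v.2 _⟩
      map_add' := fun v v' => Subtype.ext <| by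
        ext b ω
        simp only [Submodule.coe_add, Pi.add_apply, LinearMap.add_apply]
        rw [← Submodule.coe_add, hV.1.expand_eq, hV.1.expand_eq, hV.1.expand_eq,
          ← Pi.add_apply (expand _), ← expand_add (hV.1.quasi u v ω) (hV.1.quasi u v' ω)]
        congr 1
        ext g
        simp [pairSeries]
      map_smul' := fun c v => Subtype.ext <| by
        ext b ω
        simp only [Submodule.coe_smul, Pi.smul_apply, LinearMap.smul_apply, RingHom.id_apply]
        rw [← Submodule.coe_smul, hV.1.expand_eq, hV.1.expand_eq,
          ← Pi.smul_apply c (expand _), ← expand_smul c (hV.1.quasi u v ω)]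
        congr 1
        ext g
        simp [pairSeries] }
  map_add' u u' := by
    ext a v b ω
    simp only [LinearMap.coe_mk, AddHom.coe_mk, Submodule.coe_add, Pi.add_apply,
      LinearMap.add_apply]
    rw [← Submodule.coe_add, hV.1.expand_eq, hV.1.expand_eq, hV.1.expand_eq,
      ← Pi.add_apply (expand _), ← expand_add (hV.1.quasi u v ω) (hV.1.quasi u' v ω)]
    rfl
  map_smul' c u := by
    ext a v b ω
    simp only [LinearMap.coe_mk, AddHom.coe_mk, Submodule.coe_smul, Pi.smul_apply,
      LinearMap.smul_apply, RingHom.id_apply]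
    rw [← Submodule.coe_smul, hV.1.expand_eq, hV.1.expand_eq,
      ← Pi.smul_apply c (expand _), ← expand_smul c (hV.1.quasi u v ω)]
    rfl

variable (hV : IsClosedLocalSubspace V)

theorem naturalY_apply (u v : V) (a b : Exp n) (ω : W) :
    (naturalY hV u a v : OpSeries (Exp n) W) b ω =
      expand (pairSeries (u : OpSeries (Exp n) W) v ω) (a, b) :=
  hV.1.expand_eq u v a b ω

/-- The coefficients of the elements of `V`, applied to a vector. -/
def evalAt (V : Submodule ℂ (OpSeries (Exp n) W)) (b : Exp n) (ω : W) : V →ₗ[ℂ] W where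
  toFun v := (v : OpSeries (Exp n) W) b ω
  map_add' _ _ := rfl
  map_smul' _ _ := rfl

theorem naturalY_mem_VO (u : V) : naturalY hV u ∈ VO n V := by
  intro v
  obtain ⟨K, hK⟩ := (hV.1.2 _ u.2 _ v.2).isLaurent (hV.1.1 u.2) (hV.1.1 v.2)
  refine ⟨fun _ => -(K : ℤ), fun a ha => ?_⟩
  by_contra h
  refine ha (Subtype.ext ?_)
  ext b ω
  rw [naturalY_apply]
  exact not_imp_comm.1 (le_of_expand_ne_zero (hK ω)) h

/-- Substituting y + z in a constant series produces no z, so the expansion of 1(y + z)φ(y) is φ(y).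
-/
theorem naturalY_idSeries (h1 : idSeries n W ∈ V) :
    naturalY hV ⟨idSeries n W, h1⟩ = idSeries n V := by
  ext a φ b ω
  have hL : IsLaurent (pairSeries (idSeries n W) φ.1 ω) := isLaurent_prod
    ⟨0, fun g hg => by
      by_contra h
      have h0 : g.1 ≠ 0 := fun h' => h h'.ge
      exact hg (by simp [pairSeries, idSeries, Pi.single_eq_of_ne h0])⟩
    (pairSeries_mem_boundedSub _ (hV.1.1 φ.2) ω)
  rw [naturalY_apply, expand_of_isLaurent hL, taylor, finsum_eq_single _ 0 fun r hr => by
    simp [pairSeries, idSeries, Pi.single_eq_of_ne hr]]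
  simp only [pairSeries, idSeries, Pi.single_eq_same, vecChoose_zero_left, Module.End.one_apply]
  by_cases ha : a = 0
  · subst ha; simp
  · simp [ha]

/-- Y(u, z)1 is the Taylor series u(y + z): only nonnegative powers of z occur, and the constant
term is u. This gives both creation axioms. -/
theorem naturalY_apply_idSeries (h1 : idSeries n W ∈ V) (u : V) (a b : Exp n) (ω : W) :
    (naturalY hV u a ⟨idSeries n W, h1⟩ : OpSeries (Exp n) W) b ω =
      vecChoose (b + a) a • (u : OpSeries (Exp n) W) (b + a) ω := by
  have hs : ∀ a b, b ≠ 0 → pairSeries (u : OpSeries (Exp n) W) (idSeries n W) ω (a, b) = 0 :=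
    fun a b hb => by simp [pairSeries, idSeries, Pi.single_eq_of_ne hb]
  have hL : IsLaurent (pairSeries (u : OpSeries (Exp n) W) (idSeries n W) ω) := by
    obtain ⟨l, hl⟩ := hV.1.1 u.2 ω
    refine ⟨(l, 0), fun g hg => ?_⟩
    have h0 : g.2 = 0 := not_imp_comm.1 (hs g.1 g.2) hg
    refine ⟨hl fun h => hg ?_, h0.ge⟩
    have h : u.1 g.1 ω = 0 := h
    simp [pairSeries, h0, idSeries, h]
  rw [naturalY_apply, expand_of_isLaurent hL, taylor, finsum_eq_single _ (b + a) fun r hr => by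
    rw [hs _ _ (sub_ne_zero.2 (Ne.symm hr)), smul_zero]]
  simp [pairSeries, idSeries]

/-- This and the next five lemmas form a dictionary: the iterated expansions of products of three
operators are the iterated vertex operators on `V`. Each also checks that the next expansion is
defined. -/
theorem expand₂₃_tripleSeries (u v w : V) (ω : W) :
    tripleSeries u.1 v.1 w.1 ω ∈ quasiAlong (place₂₃ n) W ∧
    expandAlong (place₂₃ n) (tripleSeries u.1 v.1 w.1 ω) =
      fun g => u.1 g.1 ((naturalY hV v g.2.1 w : OpSeries (Exp n) W) g.2.2 ω) := by
  refine ⟨fun a => quasiLaurent_map (hV.1.quasi v w ω) (u.1 a), ?_⟩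
  ext ⟨a, j, b⟩
  rw [naturalY_apply]
  exact expand_map (u.1 a) (hV.1.quasi v w ω) (j, b)

theorem expand₁₃_expand₂₃_tripleSeries (u v w : V) (ω : W) :
    expandAlong (place₂₃ n) (tripleSeries u.1 v.1 w.1 ω) ∈ quasiAlong (place₁₃ n) W ∧
    expandAlong (place₁₃ n) (expandAlong (place₂₃ n) (tripleSeries u.1 v.1 w.1 ω)) =
      fun g => (naturalY hV u g.1 (naturalY hV v g.2.1 w) : OpSeries (Exp n) W) g.2.2 ω := by
  rw [(expand₂₃_tripleSeries hV u v w ω).2]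
  refine ⟨fun j => hV.1.quasi u (naturalY hV v j w) ω, ?_⟩
  ext ⟨i, j, b⟩
  rw [naturalY_apply]
  rfl

theorem expand₁₃_swap (u v w : V) (ω : W) :
    (fun g : Exp n × Exp n × Exp n => v.1 g.2.1 (u.1 g.1 (w.1 g.2.2 ω))) ∈
      quasiAlong (place₁₃ n) W ∧
    (expandAlong (place₁₃ n) fun g => v.1 g.2.1 (u.1 g.1 (w.1 g.2.2 ω))) =
      fun g => v.1 g.2.1 ((naturalY hV u g.1 w : OpSeries (Exp n) W) g.2.2 ω) := by
  refine ⟨fun b => quasiLaurent_map (hV.1.quasi u w ω) (v.1 b), ?_⟩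
  ext ⟨i, b, c⟩
  rw [naturalY_apply]
  exact expand_map (v.1 b) (hV.1.quasi u w ω) (i, c)

theorem expand₂₃_expand₁₃_swap (u v w : V) (ω : W) :
    (expandAlong (place₁₃ n) fun g => v.1 g.2.1 (u.1 g.1 (w.1 g.2.2 ω))) ∈
      quasiAlong (place₂₃ n) W ∧
    (expandAlong (place₂₃ n) (expandAlong (place₁₃ n)
      fun g => v.1 g.2.1 (u.1 g.1 (w.1 g.2.2 ω)))) =
      fun g => (naturalY hV v g.2.1 (naturalY hV u g.1 w) : OpSeries (Exp n) W) g.2.2 ω := by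
  rw [(expand₁₃_swap hV u v w ω).2]
  refine ⟨fun i => hV.1.quasi v (naturalY hV u i w) ω, ?_⟩
  ext ⟨i, j, b⟩
  rw [naturalY_apply]
  rfl

theorem expand₁₂_tripleSeries (u v w : V) (ω : W) :
    tripleSeries u.1 v.1 w.1 ω ∈ quasiAlong (place₁₂ n) W ∧
    expandAlong (place₁₂ n) (tripleSeries u.1 v.1 w.1 ω) =
      fun g => (naturalY hV u g.1 v : OpSeries (Exp n) W) g.2.1 (w.1 g.2.2 ω) := by
  refine ⟨fun c => hV.1.quasi u v (w.1 c ω), ?_⟩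
  ext ⟨i, b, c⟩
  rw [naturalY_apply]
  rfl

theorem expand₂₃_expand₁₂_tripleSeries (u v w : V) (ω : W) :
    expandAlong (place₁₂ n) (tripleSeries u.1 v.1 w.1 ω) ∈ quasiAlong (place₂₃ n) W ∧
    expandAlong (place₂₃ n) (expandAlong (place₁₂ n) (tripleSeries u.1 v.1 w.1 ω)) =
      fun g => (naturalY hV (naturalY hV u g.1 v) g.2.1 w : OpSeries (Exp n) W) g.2.2 ω := by
  rw [(expand₁₂_tripleSeries hV u v w ω).2]
  refine ⟨fun i => hV.1.quasi (naturalY hV u i v) w ω, ?_⟩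
  ext ⟨i, j, b⟩
  rw [naturalY_apply]
  rfl

theorem exists_isLaurent_diff_tripleSeries {k : ℕ} {u v : V}
    (huv : LocalOfOrder k (u : OpSeries (Exp n) W) v) (hV : IsLocalSubspace V) (w : V) :
    ∃ N : ℕ, ∀ ω, IsLaurent (act₃ W (diff₁₂ n k * diff₁₃ n N * diff₂₃ n N)
      (tripleSeries u.1 v.1 w.1 ω)) := by
  obtain ⟨N, hN⟩ := mutuallyLocal_iff_exists.1 (hV.2 _ u.2 _ w.2)
  obtain ⟨N', hN'⟩ := mutuallyLocal_iff_exists.1 (hV.2 _ v.2 _ w.2)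
  exact ⟨max N N', isLaurent_diff_tripleSeries (hV.1 u.2) (hV.1 v.2) (hV.1 w.2) huv
    (hN.mono (le_max_left _ _)) (hN'.mono (le_max_right _ _))⟩

/-- The order of locality on `W` is inherited: the factor (x - y)^k is unchanged by the simultaneous
substitution x ↦ z + x, y ↦ z + y. Equality in `V` is tested on coefficients applied to vectors. -/
theorem mutuallyLocal_naturalY (u v : V) : MutuallyLocal (naturalY hV u) (naturalY hV v) := by
  obtain ⟨k, hk⟩ := mutuallyLocal_iff_exists.1 (hV.1.2 _ u.2 _ v.2)
  refine mutuallyLocal_iff.2 ⟨k, fun w => ?_⟩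
  obtain ⟨N, hN⟩ := exists_isLaurent_diff_tripleSeries hk hV.1 w
  ext ⟨i, j⟩ b ω
  have h := congrFun (act₃_expand₁₃_expand₂₃_comm (act₃_diff₁₂_tripleSeries hk w.1 ω) (hN ω)
    (expand₂₃_tripleSeries hV u v w ω).1 (expand₁₃_expand₂₃_tripleSeries hV u v w ω).1
    (expand₁₃_swap hV u v w ω).1 (expand₂₃_expand₁₃_swap hV u v w ω).1) (i, j, b)
  rw [act₃_diff₁₂_apply, act₃_diff₁₂_apply, (expand₁₃_expand₂₃_tripleSeries hV u v w ω).2,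
    (expand₂₃_expand₁₃_swap hV u v w ω).2] at h
  exact (polyEnd_map _ (evalAt V b ω) _ _ _).trans
    (h.trans (polyEnd_map _ (evalAt V b ω) _ _ _).symm)

/-- Associativity on `V`, the hypothesis of `jacobiIdentity_of_nthProd` for the adjoint action. It
is the composition law of the substitutions, read through the dictionary for u(x)v(y)w(z)ω. -/
theorem naturalY_naturalY (u v : V) (c : Exp n) :
    naturalY hV (naturalY hV u c v) = nthProd (naturalY hV u) (-c - 1) (naturalY hV v) := by
  have hu := naturalY_mem_VO hV u
  have hv := naturalY_mem_VO hV v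
  have huv := mutuallyLocal_naturalY hV u v
  obtain ⟨k, hk⟩ := mutuallyLocal_iff_exists.1 (hV.1.2 _ u.2 _ v.2)
  obtain ⟨K, hK⟩ := (hV.1.2 _ u.2 _ v.2).isLaurent (hV.1.1 u.2) (hV.1.1 v.2)
  obtain ⟨K', hK'⟩ := huv.isLaurent hu hv
  ext j w b ω
  obtain ⟨N, hN⟩ := exists_isLaurent_diff_tripleSeries hk hV.1 w
  have hq : ∀ b, (fun p : Exp n × Exp n =>
      (naturalY hV u p.1 (naturalY hV v p.2 w) : OpSeries (Exp n) W) b ω) ∈ quasiLaurent n W :=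
    fun b => quasiLaurent_map (F := pairSeries (naturalY hV u) (naturalY hV v) w) ⟨K', hK' w⟩
      (evalAt V b ω)
  have h₃ : expandAlong (place₁₂ n) (expandAlong (place₁₃ n) (expandAlong (place₂₃ n)
      (tripleSeries u.1 v.1 w.1 ω))) = fun g =>
        evalAt V g.2.2 ω (expand (pairSeries (naturalY hV u) (naturalY hV v) w) (g.1, g.2.1)) := by
    rw [(expand₁₃_expand₂₃_tripleSeries hV u v w ω).2]
    ext ⟨i, j, b⟩
    exact expand_map (evalAt V b ω) ⟨K', hK' w⟩ (i, j)
  -- The bounds on x-exponents needed to cancel x + y are the pole orders: `K'` for Y(u) and Y(v) on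
  -- `V`, `K` for u and v on `W`.
  have h := congrFun (expand₁₂_expand₁₃_expand₂₃_eq (hN ω) (expand₂₃_tripleSeries hV u v w ω).1
    (expand₁₃_expand₂₃_tripleSeries hV u v w ω).1
    (by rw [(expand₁₃_expand₂₃_tripleSeries hV u v w ω).2]; exact hq)
    (expand₁₂_tripleSeries hV u v w ω).1 (expand₂₃_expand₁₂_tripleSeries hV u v w ω).1
    ⟨fun _ => -(K' : ℤ), fun g hg => ?_⟩ ⟨fun _ => -(K : ℤ), fun g hg => ?_⟩) (c, j, b)
  · rw [h₃, (expand₂₃_expand₁₂_tripleSeries hV u v w ω).2] at h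
    rw [← expand_pairSeries hu hv huv]
    exact h.symm
  · rw [h₃] at hg
    exact le_of_expand_ne_zero (hK' w) (i := g.1) (b := g.2.1) fun h => hg (by
      simp only [h, map_zero])
  · rw [(expand₂₃_expand₁₂_tripleSeries hV u v w ω).2] at hg
    by_contra hi
    have : naturalY hV u g.1 v = 0 := by
      refine Subtype.ext ?_
      ext b ω
      rw [naturalY_apply]
      exact not_imp_comm.1 (le_of_expand_ne_zero (hK ω)) hi
    exact hg (by simp only [this, map_zero]; rfl)

theorem isVertexAlgebraWithNaturalModule (hV : IsClosedLocalSubspace V) (h1 : idSeries n W ∈ V) :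
    IsVertexAlgebraWithNaturalModule V := by
  let A : GVertexAlgebra n V :=
    { Y := naturalY hV
      one := ⟨idSeries n W, h1⟩
      truncation := naturalY_mem_VO hV
      vacuum := naturalY_idSeries hV h1
      creation := fun v a ha => by
        refine Subtype.ext ?_
        ext b ω
        rw [naturalY_apply_idSeries, vecChoose_eq_zero ha, zero_smul]
        rfl
      creation_zero := fun v => by
        refine Subtype.ext ?_
        ext b ω
        rw [naturalY_apply_idSeries, vecChoose_zero_right, one_smul, add_zero]
      weak_comm := mutuallyLocal_naturalY hV
      jacobi := fun u v => by
        obtain ⟨K, hK⟩ := (mutuallyLocal_naturalY hV u v).isLaurent (naturalY_mem_VO hV u)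
          (naturalY_mem_VO hV v)
        exact jacobiIdentity_of_nthProd (naturalY_mem_VO hV v) hK (naturalY_naturalY hV u v) }
  let M : GVertexModule A W :=
    { Y := V.subtype
      truncation := fun v => hV.1.1 v.2
      vacuum := rfl
      weak_comm := fun u v => hV.1.2 _ u.2 _ v.2
      jacobi := fun u v => by
        obtain ⟨K, hK⟩ := (hV.1.2 _ u.2 _ v.2).isLaurent (hV.1.1 u.2) (hV.1.1 v.2)
        exact jacobiIdentity_of_nthProd (YW := V.subtype) (hV.1.1 v.2) hK fun c => rfl }
  refine ⟨A, rfl, fun ψ φ m => ?_, M, fun ψ => rfl⟩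
  change nthProd _ (-(-m - 1) - 1) _ = _
  congr 1; abel

end NaturalStructure

/-! ### Maximal local subspaces -/

section Maximal

variable {n : ℕ} {W : Type*} [AddCommGroup W] [Module ℂ W]
  {V : Submodule ℂ (OpSeries (Exp n) W)}

/-- Mutual locality is symmetric and is preserved by linear combinations, so adjoining ψ to `V`
keeps it local; maximality then forces ψ ∈ `V`. -/
theorem mem_of_maximal_isLocalSubspace (hV : Maximal IsLocalSubspace V)
    {ψ : OpSeries (Exp n) W} (hψ : ψ ∈ VO n W) (hψψ : MutuallyLocal ψ ψ)
    (h : ∀ φ ∈ V, MutuallyLocal ψ φ) : ψ ∈ V := by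
  have hloc : IsLocalSubspace (V ⊔ Submodule.span ℂ {ψ}) := by
    refine ⟨sup_le hV.prop.1 ((Submodule.span_singleton_le_iff_mem _ _).2 hψ), ?_⟩
    have key : ∀ χ, (∀ φ ∈ V, MutuallyLocal φ χ) → MutuallyLocal ψ χ →
        ∀ φ ∈ V ⊔ Submodule.span ℂ {ψ}, MutuallyLocal φ χ := fun χ h1 h2 φ hφ => by
      obtain ⟨a, ha, b, hb, rfl⟩ := Submodule.mem_sup.1 hφ
      obtain ⟨c, rfl⟩ := Submodule.mem_span_singleton.1 hb
      exact (h1 a ha).add_left (h2.smul_left c)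
    intro φ hφ χ hχ
    refine key χ (fun φ hφ => ?_) ?_ φ hφ
    · exact (key φ (fun χ hχ => hV.prop.2 χ hχ φ hφ) (h φ hφ) χ hχ).symm
    · exact (key ψ (fun χ hχ => (h χ hχ).symm) hψψ χ hχ).symm
  exact hV.le_of_ge hloc le_sup_left
    (Submodule.mem_sup_right (Submodule.mem_span_singleton_self ψ))

theorem isClosedLocalSubspace_of_maximal (hV : Maximal IsLocalSubspace V) :
    IsClosedLocalSubspace V := by
  refine ⟨hV.prop, fun ψ hψ φ hφ m => ?_⟩
  have hψ' := hV.prop.1 hψ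
  have hφ' := hV.prop.1 hφ
  have hlocal := hV.prop.2
  have h : ∀ χ ∈ V, MutuallyLocal (nthProd ψ m φ) χ := fun χ hχ =>
    (hlocal ψ hψ φ hφ).nthProd_left hψ' hφ' (hlocal ψ hψ χ hχ) (hlocal φ hφ χ hχ) m
  -- Locality of ψ_m φ with itself is a second use of Dong's lemma, with ψ_m φ as the third
  -- operator; its hypotheses are the locality with ψ and φ just obtained.
  exact mem_of_maximal_isLocalSubspace hV (nthProd_mem_VO hψ' hφ' (hlocal ψ hψ φ hφ) m)
    ((hlocal ψ hψ φ hφ).nthProd_left hψ' hφ' (h ψ hψ).symm (h φ hφ).symm m) h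

theorem idSeries_mem_of_maximal (hV : Maximal IsLocalSubspace V) : idSeries n W ∈ V :=
  mem_of_maximal_isLocalSubspace hV (idSeries_mem_VO n W) (mutuallyLocal_idSeries_left _)
    fun _ _ => mutuallyLocal_idSeries_left _

end Maximal

end GVertex

theorem theorem4p17 (n : ℕ) (hn : 0 < n) (W : Type*) [AddCommGroup W] [Module ℂ W] :
    (∀ V : Submodule ℂ (GVertex.OpSeries (GVertex.Exp n) W),
      GVertex.IsClosedLocalSubspace V → GVertex.idSeries n W ∈ V →
        GVertex.IsVertexAlgebraWithNaturalModule V) ∧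
    (∀ V : Submodule ℂ (GVertex.OpSeries (GVertex.Exp n) W),
      Maximal GVertex.IsLocalSubspace V →
        GVertex.IsClosedLocalSubspace V ∧ GVertex.idSeries n W ∈ V ∧
          GVertex.IsVertexAlgebraWithNaturalModule V) :=
  ⟨fun _ hV h1 => GVertex.isVertexAlgebraWithNaturalModule hV h1, fun _ hV =>
    have hc := GVertex.isClosedLocalSubspace_of_maximal hV
    have h1 := GVertex.idSeries_mem_of_maximal hV
    ⟨hc, h1, GVertex.isVertexAlgebraWithNaturalModule hc h1⟩⟩
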